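/- Let $I=(-1,1)$, $\beta>0$, $y_d\in L_2(I)$, $f\in H^1(I)$, $\psi\in H^2(I)$ with $\psi(1)\ge 0$. Let $$V=\{v\in H^2(I): v(-1)=v'(1)=0\},\qquad K=\{y\in V: y'\le\psi \text{ on } I\},\qquad H^1(I;1)=\{v\in H^1(I): v(1)=0\}.$$ Consider the optimal control problem of minimizing $J(y,u)=\frac12\big[\|y-y_d\|_{L_2(I)}^2+\beta\|u\|_{L_2(I)}^2\big]$ over all $(y,u)\in H^2(I)\times L_2(I)$ with $-y''=u+f$ and $y'\le\psi$ on $I$ and $y(-1)=y'(1)=0$. A function $\bar y$ is an optimal state (i.e. $(\bar y,\bar u)$ is a minimizer for some $\bar u$) if and only if $\bar y\in K$ and $$\int_I(\bar y-y_d)(y-\bar y)\,dx+\beta\int_I(\bar y''+f)(y''-\bar y'')\,dx\ge 0\qquad\forall\,y\in K,$$ and in that case the following holds. 1. $\bar y\in H^3(I)$. 2. There are $\rho\in L_2(I)$ with $\rho\ge0$ and a number $\gamma\ge0$ such that the measure $d\mu=\beta(\rho\,dx+\gamma\,d\delta_{-1})$ on $[-1,1]$ is a multiplier for $\bar y$,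 that is, $\mu$ is a nonnegative finite Borel measure on $[-1,1]$ with $$\int_I(\bar y-y_d)z\,dx+\beta\int_I(\bar y''+f)z''\,dx+\int_{[-1,1]}z'\,d\mu=0\quad\forall\,z\in V,\qquad \int_{[-1,1]}(\bar y'-\psi)\,d\mu=0 .$$ Every multiplier for $\bar y$ equals this measure up to a nonnegative multiple of $\delta_1$, and is equal to it if $\psi(1)>0$. 3. With these $\rho,\gamma$, there are $\Phi\in H^1(I;1)$ with $\beta\Phi'=y_d-\bar y$ and $p\in H^2(I)$ with $p(1)=0$ such that $$\int_I p'q'\,dx=-\int_I\Phi q\,dx+\int_I(f'-\rho)q\,dx+[f(-1)-\gamma]\,q(-1)\qquad\forall\,q\in H^1(I;1),$$ $p\le\psi$ on $I$, and $p$ solves the second order obstacle problem $$-f(-1)[q(-1)-p(-1)]+\int_I(\Phi-f')(q-p)\,dx+\int_I p'(q'-p')\,dx\ge0\qquad\forall\,q\in H^1(I;1)\text{ with }q\le\psi\text{ on }I.$$ Moreover $\bar y'=p$, $\bar y''=p'$, $\rho=p''+f'-\Phi$ on $I$, and $\gamma=f(-1)+p'(-1)$. -/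

import Mathlib

open MeasureTheory Set
open scoped ContDiff

namespace DerivativeConstraint

noncomputable section

/-- The open interval `I = (-1, 1)`. -/
def I : Set ℝ := Ioo (-1) 1

/-- Lebesgue measure on `I`. -/
def volI : Measure ℝ := volume.restrict I

/-- `w` is a weak derivative of `v` on `I`. -/
def HasWeakDeriv (v w : ℝ → ℝ) : Prop :=
  LocallyIntegrableOn v I volume ∧ LocallyIntegrableOn w I volume ∧
    ∀ φ : ℝ → ℝ, ContDiff ℝ ∞ φ → HasCompactSupport φ → tsupport φ ⊆ I →
      ∫ x in I, v x * deriv φ x = - ∫ x in I, w x * φ x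

/-- `v ∈ L₂(I)`. -/
def MemL2 (v : ℝ → ℝ) : Prop := MemLp v 2 volI

/-- `v ∈ Hᵏ(I)`: `v` and its weak derivatives up to order `k` belong to `L₂(I)`. -/
def MemH : ℕ → (ℝ → ℝ) → Prop
  | 0, v => MemL2 v
  | k + 1, v => MemL2 v ∧ ∃ w, HasWeakDeriv v w ∧ MemH k w

open Classical in
/-- The weak derivative of `v` on `I` (determined almost everywhere on `I`; `0` if there is none). -/
def wd (v : ℝ → ℝ) : ℝ → ℝ :=
  if h : ∃ w, HasWeakDeriv v w then h.choose else 0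

open Classical in
/-- The continuous representative of `v`. Its values on `[-1, 1]` are determined by the
almost-everywhere class of `v` on `I`; every function in `H¹(I)` has one. It gives the point
values of `v`, those at the two end points included. (Without any continuous representative,
the value is `v` itself.) -/
def rep (v : ℝ → ℝ) : ℝ → ℝ :=
  if h : ∃ g : ℝ → ℝ, Continuous g ∧ v =ᵐ[volI] g then h.choose else v

/-- `H¹(I; 1) = {v ∈ H¹(I) : v(1) = 0}`. -/
def MemH1Right (v : ℝ → ℝ) : Prop := MemH 1 v ∧ rep v 1 = 0

/-- `V = {v ∈ H²(I) : v(-1) = v'(1) = 0}`. -/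
def MemV (v : ℝ → ℝ) : Prop := MemH 2 v ∧ rep v (-1) = 0 ∧ rep (wd v) 1 = 0

/-- `K = {y ∈ V : y' ≤ ψ on I}`. -/
def MemK (ψ y : ℝ → ℝ) : Prop := MemV y ∧ wd y ≤ᵐ[volI] ψ

/-- The cost functional `J(y, u)`. -/
def J (β : ℝ) (yd y u : ℝ → ℝ) : ℝ :=
  (1 / 2) * ((∫ x in I, (y x - yd x) ^ 2) + β * ∫ x in I, u x ^ 2)

/-- Admissible pairs: `y ∈ H²(I)`, `u ∈ L₂(I)`, `-y'' = u + f` and `y' ≤ ψ` on `I`,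
`y(-1) = y'(1) = 0`. -/
structure Admissible (f ψ y u : ℝ → ℝ) : Prop where
  state_mem : MemH 2 y
  control_mem : MemL2 u
  state_eq : ∀ᵐ x ∂volI, - wd (wd y) x = u x + f x
  constraint : wd y ≤ᵐ[volI] ψ
  left_bc : rep y (-1) = 0
  right_bc : rep (wd y) 1 = 0

/-- `(y, u)` solves the optimal control problem. -/
def IsOptimalPair (β : ℝ) (yd f ψ y u : ℝ → ℝ) : Prop :=
  Admissible f ψ y u ∧ ∀ z v, Admissible f ψ z v → J β yd y u ≤ J β yd z v

/-- `y` is an optimal state. -/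
def IsOptimalState (β : ℝ) (yd f ψ y : ℝ → ℝ) : Prop :=
  ∃ u, IsOptimalPair β yd f ψ y u

/-- `y` solves the fourth order variational inequality. -/
def SolvesVI (β : ℝ) (yd f ψ y : ℝ → ℝ) : Prop :=
  MemK ψ y ∧ ∀ z, MemK ψ z →
    0 ≤ (∫ x in I, (y x - yd x) * (z x - y x)) +
      β * ∫ x in I, (wd (wd y) x + f x) * (wd (wd z) x - wd (wd y) x)

/-- `μ` is a multiplier for the state `y`: a nonnegative finite Borel measure on `[-1, 1]` for
which the Karush-Kuhn-Tucker conditions hold. -/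
structure IsMultiplier (β : ℝ) (yd f ψ y : ℝ → ℝ) (μ : Measure ℝ) : Prop where
  finite : IsFiniteMeasure μ
  carried : μ (Icc (-1) 1)ᶜ = 0
  stationarity : ∀ z, MemV z →
    (∫ x in I, (y x - yd x) * z x) + β * (∫ x in I, (wd (wd y) x + f x) * wd (wd z) x) +
      ∫ x in Icc (-1) 1, rep (wd z) x ∂μ = 0
  complementarity : ∫ x in Icc (-1) 1, (rep (wd y) x - rep ψ x) ∂μ = 0

/-- The measure `β (ρ dx + γ δ₋₁)`, for `ρ ≥ 0` on `I` and `β, γ ≥ 0`. -/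
def structuredMeasure (β : ℝ) (ρ : ℝ → ℝ) (γ : ℝ) : Measure ℝ :=
  ENNReal.ofReal β •
    (volI.withDensity (fun x => ENNReal.ofReal (ρ x)) +
      ENNReal.ofReal γ • Measure.dirac (-1))

/-- `Φ ∈ H¹(I; 1)` with `β Φ' = y_d - y`. -/
def IsPotential (β : ℝ) (yd y Φ : ℝ → ℝ) : Prop :=
  MemH1Right Φ ∧ ∀ᵐ x ∂volI, β * wd Φ x = yd x - y x

/-- `p` solves the second order obstacle problem with mixed boundary conditions, over
`{q ∈ H¹(I; 1) : q ≤ ψ on I}`. -/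
def SolvesObstacle (f ψ Φ p : ℝ → ℝ) : Prop :=
  (MemH1Right p ∧ p ≤ᵐ[volI] ψ) ∧ ∀ q, MemH1Right q → q ≤ᵐ[volI] ψ →
    0 ≤ - (rep f (-1) * (rep q (-1) - rep p (-1))) +
      (∫ x in I, (Φ x - wd f x) * (q x - p x)) +
      ∫ x in I, wd p x * (wd q x - wd p x)

/-- `p` satisfies the adjoint equation: the weak form of `-p'' = -Φ + f' - ρ` on `I`,
`p'(-1) = γ - f(-1)`, `p(1) = 0`. -/
def SolvesAdjoint (f Φ ρ : ℝ → ℝ) (γ : ℝ) (p : ℝ → ℝ) : Prop :=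
  MemH1Right p ∧ ∀ q, MemH1Right q →
    ∫ x in I, wd p x * wd q x =
      - (∫ x in I, Φ x * q x) + (∫ x in I, (wd f x - ρ x) * q x) +
        (rep f (-1) - γ) * rep q (-1)

end

end DerivativeConstraint

namespace DerivativeConstraint

noncomputable section

/-! The cost is a convex quadratic and the control is determined by the state, so optimality is
equivalent to the variational inequality (`isOptimalState_iff_solvesVI`).

For the rest, put `p = y'`, `v = ψ - p ≥ 0`, and let `Φ` satisfy `β Φ' = y_d - y`, `Φ(1) = 0`.
Perturb `y` by the primitive of some `Q ∈ H¹(I; 1)` with `Q ≤ v`. Two integrations by parts turn the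
inequality into `∫ g Q' ≥ 0`, where `g = y'' + f - ∫Φ` (`SolvesVI.nonnegBelow`). This is an obstacle
problem for `p`, and everything rests on showing that `g`, so far only in `L₂`, lies in `H¹`.

Piecewise affine `Q` show that `g` is nonnegative, nondecreasing, and constant wherever `v > 0`.
Moreover `v' = G - g` with `G = ψ' + f - ∫Φ` in `H¹`. At a contact point `v` has a minimum, which
compares `G` there with the values of `g` on either side. Applied at the first and last contact
points between `s` and `t`, this gives `g(t) - g(s) ≤ ∫ |G'|` over `[s, t]`
(`NonnegBelow.sub_le_integral_abs`). A nondecreasing function with this bound is absolutely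
continuous, and its derivative is dominated by `|G'|` (`NonnegBelow.exists_isPrimitive`).

With `ρ = g' ≥ 0` and `γ = g(-1) ≥ 0`, integration by parts gives `∫ g Q' = -∫ ρ Q - γ Q(-1)`. This
is the multiplier, and the formula for `g` gives `y ∈ H³` and the adjoint equation. Stationarity,
tested with ramps, fixes any multiplier on `[-1, 1)`. It cannot see the point `1`, where `z' = 0`;
there complementarity decides if `ψ(1) > 0`. -/

instance : IsFiniteMeasure volI := ⟨by simp [volI, I]⟩

/-! ### Integration over `I` -/

theorem measurableSet_I : MeasurableSet I := measurableSet_Ioo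

theorem ae_volI_iff {P : ℝ → Prop} : (∀ᵐ x ∂volI, P x) ↔ ∀ᵐ x, x ∈ I → P x :=
  ae_restrict_iff' measurableSet_I

theorem ae_volI_mem : ∀ᵐ x ∂volI, x ∈ I := ae_restrict_mem measurableSet_I

theorem integral_I (f : ℝ → ℝ) : ∫ x in I, f x = ∫ x in (-1)..1, f x := by
  rw [intervalIntegral.integral_of_le (by norm_num), integral_Ioc_eq_integral_Ioo, I]

theorem integral_I_congr {f g : ℝ → ℝ} (h : f =ᵐ[volI] g) : ∫ x in I, f x = ∫ x in I, g x :=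
  integral_congr_ae h

theorem integral_I_add {f g : ℝ → ℝ} (hf : Integrable f volI) (hg : Integrable g volI) :
    ∫ x in I, (f x + g x) = (∫ x in I, f x) + ∫ x in I, g x :=
  integral_add hf hg

theorem integral_I_sub {f g : ℝ → ℝ} (hf : Integrable f volI) (hg : Integrable g volI) :
    ∫ x in I, (f x - g x) = (∫ x in I, f x) - ∫ x in I, g x :=
  integral_sub hf hg

theorem intervalIntegrable_of_integrable {w : ℝ → ℝ} (hw : Integrable w volI) {a b : ℝ}
    (ha : a ∈ Icc (-1 : ℝ) 1) (hb : b ∈ Icc (-1 : ℝ) 1) : IntervalIntegrable w volume a b := by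
  have : IntervalIntegrable w volume (-1) 1 := by
    rw [intervalIntegrable_iff_integrableOn_Ioo_of_le (by norm_num)]
    exact hw
  refine this.mono_set ?_
  rw [uIcc_of_le (by norm_num : (-1 : ℝ) ≤ 1)]
  exact uIcc_subset_Icc ha hb

theorem integrable_of_memLp {w : ℝ → ℝ} (hw : MemLp w 2 volI) : Integrable w volI :=
  hw.integrable (by norm_num)

theorem integrable_mul_of_memLp {u w : ℝ → ℝ} (hu : MemLp u 2 volI) (hw : MemLp w 2 volI) :
    Integrable (fun x => u x * w x) volI :=
  hu.integrable_mul hw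

theorem memLp_of_continuous {V : ℝ → ℝ} (hV : Continuous V) : MemLp V 2 volI := by
  obtain ⟨C, hC⟩ := (isCompact_Icc (a := (-1 : ℝ)) (b := 1)).exists_bound_of_continuousOn
    hV.continuousOn
  refine MemLp.of_bound hV.aestronglyMeasurable C ?_
  filter_upwards [ae_volI_mem] with x hx
  exact hC x ⟨hx.1.le, hx.2.le⟩

theorem locallyIntegrableOn_of_integrable {w : ℝ → ℝ} (hw : Integrable w volI) :
    LocallyIntegrableOn w I volume :=
  IntegrableOn.locallyIntegrableOn hw

/-- Continuous functions which agree almost everywhere on `I` agree on `[-1, 1]`. -/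
theorem eqOn_Icc_of_ae_eq {g h : ℝ → ℝ} (hg : Continuous g) (hh : Continuous h)
    (H : g =ᵐ[volI] h) : EqOn g h (Icc (-1) 1) := by
  have h1 : EqOn g h I :=
    Measure.eqOn_open_of_ae_eq H isOpen_Ioo hg.continuousOn hh.continuousOn
  have h2 := h1.closure hg hh
  rwa [I, closure_Ioo (by norm_num)] at h2

/-! ### Weak derivatives and the lemma of du Bois-Reymond -/

theorem integrable_mul_test {u φ : ℝ → ℝ} (hu : LocallyIntegrableOn u I volume)
    (h1 : Continuous φ) (h2 : HasCompactSupport φ) (h3 : tsupport φ ⊆ I) :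
    Integrable (fun x => u x * φ x) volume := by
  have hK : IntegrableOn u (tsupport φ) volume := hu.integrableOn_compact_subset h3 h2
  have : IntegrableOn (fun x => u x * φ x) (tsupport φ) volume :=
    hK.mul_continuousOn h1.continuousOn h2
  refine (integrableOn_iff_integrable_of_support_subset ?_).mp this
  exact (Function.support_mul_subset_right _ _).trans (subset_tsupport φ)

theorem setIntegral_mul_test {u φ : ℝ → ℝ} (h3 : tsupport φ ⊆ I) :
    ∫ x in I, u x * φ x = ∫ x, u x * φ x := by
  refine setIntegral_eq_integral_of_forall_compl_eq_zero fun x hx => ?_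
  rw [image_eq_zero_of_notMem_tsupport (fun hh => hx (h3 hh)), mul_zero]

/-- The weak derivative is unique almost everywhere. -/
theorem HasWeakDeriv.ae_eq {v w w' : ℝ → ℝ} (h : HasWeakDeriv v w) (h' : HasWeakDeriv v w') :
    w =ᵐ[volI] w' := by
  have key := isOpen_Ioo.ae_eq_zero_of_integral_contDiff_smul_eq_zero (μ := volume)
    (U := I) (h.2.1.sub h'.2.1) (fun φ h1 h2 h3 => ?_)
  · rw [Filter.EventuallyEq, ae_volI_iff]
    filter_upwards [key] with x hx hxI
    exact sub_eq_zero.mp (hx hxI)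
  have e := h.2.2 φ h1 h2 h3
  rw [h'.2.2 φ h1 h2 h3, neg_inj, setIntegral_mul_test h3, setIntegral_mul_test h3] at e
  have e2 : ∫ x, (w x - w' x) * φ x = 0 := by
    simp_rw [sub_mul]
    rw [integral_sub (integrable_mul_test h.2.1 h1.continuous h2 h3)
      (integrable_mul_test h'.2.1 h1.continuous h2 h3), e, sub_self]
  simpa [mul_comm] using e2

/-- A test function of mean zero is the derivative of a test function. -/
theorem exists_primitive_test {χ : ℝ → ℝ} (h1 : ContDiff ℝ ∞ χ) (h2 : HasCompactSupport χ)
    (h3 : tsupport χ ⊆ I) (h0 : ∫ x, χ x = 0) :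
    ∃ ζ : ℝ → ℝ, ContDiff ℝ ∞ ζ ∧ HasCompactSupport ζ ∧ tsupport ζ ⊆ I ∧ deriv ζ = χ := by
  obtain ⟨a, b, ha, hb, hab⟩ : ∃ a b : ℝ, -1 < a ∧ b < 1 ∧ ∀ x, χ x ≠ 0 → x ∈ Icc a b := by
    rcases (tsupport χ).eq_empty_or_nonempty with he | hne
    · refine ⟨0, 0, by norm_num, by norm_num, fun x hx => ?_⟩
      have := subset_tsupport χ hx
      simp [he] at this
    · obtain ⟨a, ha⟩ := IsCompact.exists_isLeast h2 hne
      obtain ⟨b, hb⟩ := IsCompact.exists_isGreatest h2 hne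
      exact ⟨a, b, (h3 ha.1).1, (h3 hb.1).2, fun x hx =>
        ⟨ha.2 (subset_tsupport χ hx), hb.2 (subset_tsupport χ hx)⟩⟩
  have hz : ∀ x, x ∉ Icc a b → χ x = 0 := fun x hx => by
    by_contra hne
    exact hx (hab x hne)
  have hc : Continuous χ := h1.continuous
  have hi : ∀ p q : ℝ, IntervalIntegrable χ volume p q := fun p q => hc.intervalIntegrable p q
  have hder : ∀ x, HasDerivAt (fun x => ∫ t in (-1)..x, χ t) (χ x) x := fun x =>
    intervalIntegral.integral_hasDerivAt_right (hi _ _)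
      hc.stronglyMeasurable.stronglyMeasurableAtFilter hc.continuousAt
  have hd : deriv (fun x => ∫ t in (-1)..x, χ t) = χ := funext fun x => (hder x).deriv
  have hsupp : tsupport (fun x => ∫ t in (-1)..x, χ t) ⊆ Icc a b := by
    refine closure_minimal ?_ isClosed_Icc
    intro x hx
    by_contra hxn
    refine hx ?_
    change ∫ t in (-1)..x, χ t = 0
    have hxn' : x < a ∨ (a ≤ x ∧ b < x) := by
      rcases lt_or_ge x a with h | h
      · exact Or.inl h
      · exact Or.inr ⟨h, not_le.mp fun h' => hxn ⟨h, h'⟩⟩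
    rcases hxn' with h | ⟨h', h⟩
    · rw [intervalIntegral.integral_congr (g := fun _ => (0 : ℝ))]
      · simp
      · intro t ht
        refine hz t fun htt => ?_
        have := ht.2
        have h5 : max (-1) x < a := max_lt ha h
        linarith [htt.1]
    -- Beyond the support the primitive equals the total integral, which is zero by assumption.
    · have e : ∫ t, χ t = ∫ t in (-1)..x, χ t := by
        refine (intervalIntegral.integral_eq_integral_of_support_subset ?_).symm
        intro t ht
        have := hab t ht
        exact ⟨by linarith [this.1], by linarith [this.2]⟩
      rw [← e, h0]
  refine ⟨_, ?_, isCompact_Icc.of_isClosed_subset (isClosed_tsupport _) hsupp,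
    hsupp.trans fun x hx => ⟨ha.trans_le hx.1, hx.2.trans_lt hb⟩, hd⟩
  rw [contDiff_infty_iff_deriv]
  exact ⟨fun x => (hder x).differentiableAt, by rwa [hd]⟩

/-- The lemma of du Bois-Reymond: a function with weak derivative zero is constant. -/
theorem ae_eq_const_of_hasWeakDeriv_zero {u : ℝ → ℝ} (h : HasWeakDeriv u 0) :
    ∃ c : ℝ, u =ᵐ[volI] fun _ => c := by
  let η : ContDiffBump (0 : ℝ) := ⟨1 / 4, 1 / 2, by norm_num, by norm_num⟩
  let θ : ℝ → ℝ := η.normed volume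
  have t1 : ContDiff ℝ ∞ θ := η.contDiff_normed
  have t2 : HasCompactSupport θ := η.hasCompactSupport_normed
  have t3 : tsupport θ ⊆ I := by
    change tsupport (η.normed volume) ⊆ I
    rw [η.tsupport_normed_eq, Real.closedBall_eq_Icc]
    intro x hx
    have h1 : (0 : ℝ) - 1 / 2 ≤ x := hx.1
    have h2 : x ≤ 0 + 1 / 2 := hx.2
    exact ⟨by linarith, by linarith⟩
  have t0 : ∫ x, θ x = 1 := η.integral_normed
  -- Since `θ` has integral one, the constant must be `∫ u θ`. For a test function `φ` with integral
  -- `k`, `φ - k θ` is the derivative of a test function, so `u` annihilates it.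
  refine ⟨∫ x, u x * θ x, ?_⟩
  have key := isOpen_Ioo.ae_eq_zero_of_integral_contDiff_smul_eq_zero (μ := volume)
    (U := I) (h.1.sub (locallyIntegrableOn_of_integrable
      (integrable_const (μ := volI) (∫ x, u x * θ x)))) (fun φ h1 h2 h3 => ?_)
  · rw [Filter.EventuallyEq, ae_volI_iff]
    filter_upwards [key] with x hx hxI
    exact sub_eq_zero.mp (hx hxI)
  have iφ : Integrable φ := h1.continuous.integrable_of_hasCompactSupport h2
  have iθ : Integrable θ := t1.continuous.integrable_of_hasCompactSupport t2
  let k := ∫ x, φ x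
  have s3 : tsupport (fun x => φ x - k * θ x) ⊆ tsupport φ ∪ tsupport θ := by
    refine (closure_mono ?_).trans (closure_union (s := Function.support φ)).le
    intro x hx
    by_contra hn
    simp only [mem_union, Function.mem_support, not_or, not_not] at hn
    exact hx (by simp [hn.1, hn.2])
  obtain ⟨ζ, z1, z2, z3, z4⟩ := exists_primitive_test (χ := fun x => φ x - k * θ x)
    (h1.sub (contDiff_const.mul t1))
    (IsCompact.of_isClosed_subset (h2.isCompact.union t2.isCompact) (isClosed_tsupport _) s3)
    (s3.trans (union_subset h3 t3))
    (by rw [integral_sub iφ (iθ.const_mul k), integral_const_mul, t0]; simp [k])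
  have e := h.2.2 ζ z1 z2 z3
  rw [z4] at e
  simp only [Pi.zero_apply, zero_mul, integral_zero, neg_zero] at e
  have iu := integrable_mul_test h.1 h1.continuous h2 h3
  have iv := integrable_mul_test h.1 t1.continuous t2 t3
  have e' : ∫ x in I, u x * (φ x - k * θ x) = (∫ x, u x * φ x) - k * ∫ x, u x * θ x := by
    rw [← setIntegral_mul_test h3, ← setIntegral_mul_test t3, ← integral_const_mul,
      ← integral_sub iu.integrableOn (iv.integrableOn.const_mul k)]
    congr 1
    ext x
    ring
  rw [e'] at e
  have : ∀ x, φ x • (u x - ∫ x, u x * θ x) = u x * φ x - φ x * ∫ x, u x * θ x := fun x => by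
    simp only [smul_eq_mul]
    ring
  simp only [Pi.sub_apply]
  simp_rw [this]
  rw [integral_sub iu (iφ.mul_const _), integral_mul_const]
  exact e

/-! ### Calculus of primitives of `L₂` functions -/

/-- `V` is continuous and is on `[-1, 1]` a primitive of `w ∈ L₂(I)`. -/
structure IsPrimitive (V w : ℝ → ℝ) : Prop where
  memLp : MemLp w 2 volI
  cont : Continuous V
  eq_add : ∀ x ∈ Icc (-1 : ℝ) 1, V x = V (-1) + ∫ t in (-1)..x, w t

namespace IsPrimitive

variable {V w Z z : ℝ → ℝ}

theorem integrable (h : IsPrimitive V w) : Integrable w volI := integrable_of_memLp h.memLp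

theorem memLp_self (h : IsPrimitive V w) : MemLp V 2 volI := memLp_of_continuous h.cont

theorem sub_eq (h : IsPrimitive V w) {a b : ℝ} (ha : a ∈ Icc (-1 : ℝ) 1)
    (hb : b ∈ Icc (-1 : ℝ) 1) : V b - V a = ∫ t in a..b, w t := by
  have m : (-1 : ℝ) ∈ Icc (-1 : ℝ) 1 := by simp
  rw [h.eq_add a ha, h.eq_add b hb, ← intervalIntegral.integral_add_adjacent_intervals
    (intervalIntegrable_of_integrable h.integrable m ha)
    (intervalIntegrable_of_integrable h.integrable ha hb)]
  ring

theorem add (h : IsPrimitive V w) (k : IsPrimitive Z z) :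
    IsPrimitive (fun x => V x + Z x) (fun x => w x + z x) where
  memLp := h.memLp.add k.memLp
  cont := h.cont.add k.cont
  eq_add x hx := by
    have m : (-1 : ℝ) ∈ Icc (-1 : ℝ) 1 := by simp
    rw [h.eq_add x hx, k.eq_add x hx, intervalIntegral.integral_add
      (intervalIntegrable_of_integrable h.integrable m hx)
      (intervalIntegrable_of_integrable k.integrable m hx)]
    ring

theorem const_mul (h : IsPrimitive V w) (c : ℝ) :
    IsPrimitive (fun x => c * V x) (fun x => c * w x) where
  memLp := h.memLp.const_mul c
  cont := continuous_const.mul h.cont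
  eq_add x hx := by
    rw [h.eq_add x hx, intervalIntegral.integral_const_mul]
    ring

theorem sub (h : IsPrimitive V w) (k : IsPrimitive Z z) :
    IsPrimitive (fun x => V x - Z x) (fun x => w x - z x) := by
  convert h.add (k.const_mul (-1)) using 2 <;> ring

theorem congr_ae (h : IsPrimitive V w) (hz : w =ᵐ[volI] z) : IsPrimitive V z where
  memLp := (memLp_congr_ae hz).mp h.memLp
  cont := h.cont
  eq_add x hx := by
    rw [h.eq_add x hx]
    congr 1
    refine intervalIntegral.integral_congr_ae ?_
    -- Interval integrals run over half-open intervals, while `I` omits its right end point.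
    have h1 : ∀ᵐ t : ℝ, t ≠ 1 := by simp [ae_iff, measure_singleton]
    filter_upwards [ae_volI_iff.mp hz, h1] with t ht ht1 htx
    rw [uIoc_of_le hx.1] at htx
    exact ht ⟨htx.1, lt_of_le_of_ne (htx.2.trans hx.2) ht1⟩

theorem of_eqOn (h : IsPrimitive V w) (hZ : Continuous Z) (e : EqOn V Z (Icc (-1) 1)) :
    IsPrimitive Z w where
  memLp := h.memLp
  cont := hZ
  eq_add x hx := by rw [← e hx, ← e (by simp), h.eq_add x hx]

end IsPrimitive

/-- The primitive of `w` on `I` with value `c` at `-1`, continued by constants. -/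
def prim (c : ℝ) (w : ℝ → ℝ) (x : ℝ) : ℝ := c + ∫ t in (-1)..x, I.indicator w t

theorem prim_neg_one (c : ℝ) (w : ℝ → ℝ) : prim c w (-1) = c := by simp [prim]

theorem prim_eq (c : ℝ) (w : ℝ → ℝ) {x : ℝ} (hx : x ∈ Icc (-1 : ℝ) 1) :
    prim c w x = c + ∫ t in (-1)..x, w t := by
  rw [prim]
  congr 1
  refine intervalIntegral.integral_congr_ae ?_
  have h1 : ∀ᵐ t : ℝ, t ≠ 1 := by simp [ae_iff, measure_singleton]
  filter_upwards [h1] with t ht1 htx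
  rw [uIoc_of_le hx.1] at htx
  exact indicator_of_mem (show t ∈ I from ⟨htx.1, lt_of_le_of_ne (htx.2.trans hx.2) ht1⟩) _

theorem isPrimitive_prim (c : ℝ) {w : ℝ → ℝ} (hw : MemLp w 2 volI) :
    IsPrimitive (prim c w) w where
  memLp := hw
  cont := by
    have hi : Integrable (I.indicator w) volume :=
      (integrable_indicator_iff measurableSet_I).mpr (integrable_of_memLp hw)
    exact continuous_const.add
      (intervalIntegral.continuous_primitive (fun a b => hi.intervalIntegrable) _)
  eq_add x hx := by rw [prim_neg_one, prim_eq c w hx]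

namespace IsPrimitive

variable {V w Z z : ℝ → ℝ}

theorem absolutelyContinuousOnInterval (h : IsPrimitive V w) :
    AbsolutelyContinuousOnInterval V (-1) 1 := by
  have m : (-1 : ℝ) ∈ Icc (-1 : ℝ) 1 := by simp
  have m' : (1 : ℝ) ∈ Icc (-1 : ℝ) 1 := by simp
  have h1 := (intervalIntegrable_of_integrable h.integrable m
    m').absolutelyContinuousOnInterval_intervalIntegral (c := -1) (by simp)
  have hu : uIcc (-1 : ℝ) 1 = Icc (-1) 1 := uIcc_of_le (by norm_num)
  have h2 : AbsolutelyContinuousOnInterval (fun _ : ℝ => V (-1)) (-1) 1 :=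
    (LipschitzWith.const (V (-1))).lipschitzOnWith.absolutelyContinuousOnInterval
  have h3 := h2.add h1
  rw [absolutelyContinuousOnInterval_iff] at h3 ⊢
  intro ε hε
  obtain ⟨δ, hδ, H⟩ := h3 ε hε
  refine ⟨δ, hδ, fun E hE hl => ?_⟩
  convert H E hE hl using 2 with i hi
  have hE' := (hE.1 i hi)
  rw [hu] at hE'
  rw [h.eq_add _ hE'.1, h.eq_add _ hE'.2]
  rfl

theorem ae_hasDerivAt (h : IsPrimitive V w) : ∀ᵐ x ∂volI, HasDerivAt V (w x) x := by
  have m : (-1 : ℝ) ∈ Icc (-1 : ℝ) 1 := by simp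
  have m' : (1 : ℝ) ∈ Icc (-1 : ℝ) 1 := by simp
  have hu : uIcc (-1 : ℝ) 1 = Icc (-1) 1 := uIcc_of_le (by norm_num)
  rw [ae_volI_iff]
  filter_upwards [(intervalIntegrable_of_integrable h.integrable m m').ae_hasDerivAt_integral]
    with x hx hxI
  have hx' : x ∈ Icc (-1 : ℝ) 1 := ⟨hxI.1.le, hxI.2.le⟩
  have := (hx (hu ▸ hx') (-1) (hu ▸ m)).const_add (V (-1))
  refine this.congr_of_eventuallyEq ?_
  filter_upwards [isOpen_Ioo.mem_nhds hxI] with t ht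
  exact h.eq_add t ⟨ht.1.le, ht.2.le⟩

/-- Integration by parts. -/
theorem integral_mul_add (h : IsPrimitive V w) (k : IsPrimitive Z z) :
    (∫ x in I, w x * Z x) + ∫ x in I, V x * z x = V 1 * Z 1 - V (-1) * Z (-1) := by
  have e := h.absolutelyContinuousOnInterval.integral_mul_deriv_eq_deriv_mul
    k.absolutelyContinuousOnInterval
  rw [← integral_I, ← integral_I] at e
  have e1 : ∫ x in I, V x * deriv Z x = ∫ x in I, V x * z x := by
    refine integral_I_congr ?_
    filter_upwards [k.ae_hasDerivAt] with x hx
    rw [hx.deriv]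
  have e2 : ∫ x in I, deriv V x * Z x = ∫ x in I, w x * Z x := by
    refine integral_I_congr ?_
    filter_upwards [h.ae_hasDerivAt] with x hx
    rw [hx.deriv]
  rw [e1, e2] at e
  linarith

/-- Supplies the test function `(1 - x) / 2 * v` used for complementarity. -/
theorem mul (h : IsPrimitive V w) (k : IsPrimitive Z z) :
    IsPrimitive (fun x => V x * Z x) (fun x => w x * Z x + V x * z x) where
  memLp := by
    obtain ⟨C, hC⟩ := (isCompact_Icc (a := (-1 : ℝ)) (b := 1)).exists_bound_of_continuousOn
      k.cont.continuousOn
    obtain ⟨D, hD⟩ := (isCompact_Icc (a := (-1 : ℝ)) (b := 1)).exists_bound_of_continuousOn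
      h.cont.continuousOn
    refine MemLp.add (MemLp.of_le_mul (c := C) h.memLp
      (h.memLp.1.mul k.cont.aestronglyMeasurable) ?_)
      (MemLp.of_le_mul (c := D) k.memLp (h.cont.aestronglyMeasurable.mul k.memLp.1) ?_)
    · filter_upwards [ae_volI_mem] with x hx
      rw [norm_mul, mul_comm]
      exact mul_le_mul_of_nonneg_right (hC x ⟨hx.1.le, hx.2.le⟩) (norm_nonneg _)
    · filter_upwards [ae_volI_mem] with x hx
      rw [norm_mul]
      exact mul_le_mul_of_nonneg_right (hD x ⟨hx.1.le, hx.2.le⟩) (norm_nonneg _)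
  cont := h.cont.mul k.cont
  eq_add x hx := by
    have hx1 : uIcc (-1) x ⊆ uIcc (-1 : ℝ) 1 := by
      rw [uIcc_of_le hx.1, uIcc_of_le (by norm_num)]
      exact Icc_subset_Icc le_rfl hx.2
    have e := (h.absolutelyContinuousOnInterval.mono hx1).integral_deriv_mul_eq_sub
      (k.absolutelyContinuousOnInterval.mono hx1)
    have e1 : ∫ t in (-1)..x, deriv V t * Z t + V t * deriv Z t =
        ∫ t in (-1)..x, w t * Z t + V t * z t := by
      refine intervalIntegral.integral_congr_ae ?_
      have h1 : ∀ᵐ t : ℝ, t ≠ 1 := by simp [ae_iff, measure_singleton]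
      filter_upwards [ae_volI_iff.mp h.ae_hasDerivAt, ae_volI_iff.mp k.ae_hasDerivAt, h1]
        with t hv hz ht1 htx
      rw [uIoc_of_le hx.1] at htx
      have ht : t ∈ I := ⟨htx.1, lt_of_le_of_ne (htx.2.trans hx.2) ht1⟩
      rw [(hv ht).deriv, (hz ht).deriv]
    rw [← e1, e]
    ring

theorem of_hasDerivAt (hd : ∀ x, HasDerivAt V (w x) x) (hw : Continuous w) : IsPrimitive V w where
  memLp := memLp_of_continuous hw
  cont := continuous_iff_continuousAt.mpr fun x => (hd x).continuousAt
  eq_add x _ := by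
    rw [intervalIntegral.integral_eq_sub_of_hasDerivAt (fun t _ => hd t)
      (hw.intervalIntegrable _ _)]
    ring

theorem hasWeakDeriv (h : IsPrimitive V w) : HasWeakDeriv V w := by
  refine ⟨h.cont.locallyIntegrable.locallyIntegrableOn _,
    locallyIntegrableOn_of_integrable h.integrable, fun φ h1 _ h3 => ?_⟩
  have k : IsPrimitive φ (deriv φ) := of_hasDerivAt
    (fun x => ((h1.differentiable (by norm_num)) x).hasDerivAt) (h1.continuous_deriv (by norm_num))
  have e := h.integral_mul_add k
  have b : ∀ x, x ∉ I → φ x = 0 := fun x hx =>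
    image_eq_zero_of_notMem_tsupport fun hh => hx (h3 hh)
  rw [b 1 (by simp [I]), b (-1) (by simp [I])] at e
  linarith

end IsPrimitive

/-! ### Sobolev functions and their continuous representatives -/

theorem HasWeakDeriv.congr {v v' w w' : ℝ → ℝ} (h : HasWeakDeriv v w) (hv : v =ᵐ[volI] v')
    (hw : w =ᵐ[volI] w') : HasWeakDeriv v' w' := by
  have loc : ∀ {u u' : ℝ → ℝ}, u =ᵐ[volI] u' → LocallyIntegrableOn u I volume →
      LocallyIntegrableOn u' I volume := fun {u u'} hu hl x hx => by
    obtain ⟨s, hs, hi⟩ := hl x hx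
    refine ⟨s ∩ I, Filter.inter_mem hs self_mem_nhdsWithin, ?_⟩
    refine (hi.mono_set inter_subset_left).congr ?_
    exact ae_restrict_of_ae_restrict_of_subset inter_subset_right hu
  refine ⟨loc hv h.1, loc hw h.2.1, fun φ h1 h2 h3 => ?_⟩
  have e1 : ∫ x in I, v' x * deriv φ x = ∫ x in I, v x * deriv φ x := by
    refine integral_I_congr ?_
    filter_upwards [hv] with x hx
    rw [hx]
  have e2 : ∫ x in I, w' x * φ x = ∫ x in I, w x * φ x := by
    refine integral_I_congr ?_
    filter_upwards [hw] with x hx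
    rw [hx]
  rw [e1, e2]
  exact h.2.2 φ h1 h2 h3

/-- The difference from the explicit primitive has weak derivative zero, so du Bois-Reymond applies.
-/
theorem HasWeakDeriv.ae_eq_prim {v w : ℝ → ℝ} (h : HasWeakDeriv v w) (hw : MemLp w 2 volI) :
    ∃ c, v =ᵐ[volI] prim c w := by
  have k := (isPrimitive_prim 0 hw).hasWeakDeriv
  have : HasWeakDeriv (fun x => v x - prim 0 w x) 0 := by
    refine ⟨h.1.sub k.1, locallyIntegrableOn_of_integrable (integrable_zero _ _ _),
      fun φ h1 h2 h3 => ?_⟩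
    have hd : tsupport (deriv φ) ⊆ I := tsupport_deriv_subset.trans h3
    have hs : HasCompactSupport (deriv φ) := h2.deriv
    have hc : Continuous (deriv φ) := h1.continuous_deriv (by norm_num)
    simp_rw [sub_mul]
    rw [integral_sub (integrable_mul_test h.1 hc hs hd).integrableOn
      (integrable_mul_test k.1 hc hs hd).integrableOn, h.2.2 φ h1 h2 h3, k.2.2 φ h1 h2 h3]
    simp
  obtain ⟨c, hc⟩ := ae_eq_const_of_hasWeakDeriv_zero this
  refine ⟨c, ?_⟩
  filter_upwards [hc] with x hx
  simp only [prim, zero_add] at hx ⊢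
  linarith

theorem HasWeakDeriv.wd_ae_eq {v w : ℝ → ℝ} (h : HasWeakDeriv v w) : wd v =ᵐ[volI] w := by
  have hex : ∃ w, HasWeakDeriv v w := ⟨w, h⟩
  have : HasWeakDeriv v (wd v) := by
    rw [wd, dif_pos hex]
    exact hex.choose_spec
  exact this.ae_eq h

theorem rep_spec {v g : ℝ → ℝ} (hg : Continuous g) (h : v =ᵐ[volI] g) :
    Continuous (rep v) ∧ v =ᵐ[volI] rep v ∧ EqOn (rep v) g (Icc (-1) 1) := by
  have hex : ∃ g : ℝ → ℝ, Continuous g ∧ v =ᵐ[volI] g := ⟨g, hg, h⟩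
  have hs : Continuous (rep v) ∧ v =ᵐ[volI] rep v := by
    rw [rep, dif_pos hex]
    exact hex.choose_spec
  exact ⟨hs.1, hs.2, eqOn_Icc_of_ae_eq hs.1 hg (hs.2.symm.trans h)⟩

theorem MemH.memLp {k : ℕ} {v : ℝ → ℝ} (h : MemH k v) : MemLp v 2 volI := by
  cases k with
  | zero => exact h
  | succ k => exact h.1

theorem MemH.congr {k : ℕ} {v v' : ℝ → ℝ} (h : MemH k v) (e : v =ᵐ[volI] v') : MemH k v' := by
  cases k with
  | zero => exact (memLp_congr_ae e).mp h
  | succ k =>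
    obtain ⟨h1, w, h2, h3⟩ := h
    exact ⟨(memLp_congr_ae e).mp h1, w, h2.congr e (Filter.EventuallyEq.refl _ _), h3⟩

theorem MemH.wd {k : ℕ} {v : ℝ → ℝ} (h : MemH (k + 1) v) : MemH k (wd v) := by
  obtain ⟨-, w, h2, h3⟩ := h
  exact h3.congr h2.wd_ae_eq.symm

theorem MemH.of_succ {k : ℕ} : ∀ {v : ℝ → ℝ}, MemH (k + 1) v → MemH k v := by
  induction k with
  | zero => exact fun h => h.1
  | succ k ih => exact fun ⟨h1, w, h2, h3⟩ => ⟨h1, w, h2, ih h3⟩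

/-- The passage from weak derivatives to the calculus of primitives; `IsPrimitive.memH`,
`IsPrimitive.wd_ae_eq` and `IsPrimitive.rep_eqOn` lead back. -/
theorem MemH.isPrimitive_rep {v : ℝ → ℝ} (h : MemH 1 v) :
    IsPrimitive (rep v) (DerivativeConstraint.wd v) ∧ v =ᵐ[volI] rep v := by
  obtain ⟨-, w, h2, h3⟩ := h
  have h3 : MemLp w 2 volI := h3
  obtain ⟨c, hc⟩ := h2.ae_eq_prim h3
  obtain ⟨r1, r2, r3⟩ := rep_spec (isPrimitive_prim c h3).cont hc
  exact ⟨((isPrimitive_prim c h3).congr_ae h2.wd_ae_eq.symm).of_eqOn r1 r3.symm, r2⟩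

theorem IsPrimitive.memH {k : ℕ} {V w v : ℝ → ℝ} (h : IsPrimitive V w) (hw : MemH k w)
    (e : v =ᵐ[volI] V) : MemH (k + 1) v :=
  MemH.congr (v := V) ⟨h.memLp_self, w, h.hasWeakDeriv, hw⟩ e.symm

theorem IsPrimitive.wd_ae_eq {V w v : ℝ → ℝ} (h : IsPrimitive V w) (e : v =ᵐ[volI] V) :
    wd v =ᵐ[volI] w :=
  (h.hasWeakDeriv.congr e.symm (Filter.EventuallyEq.refl _ _)).wd_ae_eq

theorem IsPrimitive.rep_eqOn {V w v : ℝ → ℝ} (h : IsPrimitive V w) (e : v =ᵐ[volI] V) :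
    EqOn (rep v) V (Icc (-1) 1) :=
  (rep_spec h.cont e).2.2

/-! ### Ramps, dominated monotone functions, contact points -/

/-- There is a function which is `1` up to `a`, `0` from `b` on, and affine in between. -/
theorem exists_ramp {a b : ℝ} (ha : -1 ≤ a) (hab : a < b) (hb : b ≤ 1) :
    ∃ R w : ℝ → ℝ, IsPrimitive R w ∧ (∀ x ∈ Icc (-1 : ℝ) 1, 0 ≤ R x ∧ R x ≤ 1) ∧
      (∀ x ∈ Icc (-1 : ℝ) 1, x ≤ a → R x = 1) ∧ (∀ x ∈ Icc (-1 : ℝ) 1, b ≤ x → R x = 0) ∧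
      ∀ g : ℝ → ℝ, ∫ x in I, g x * w x = -((b - a)⁻¹ * ∫ x in a..b, g x) := by
  have hba : 0 < b - a := sub_pos.mpr hab
  -- With this slope, testing `g` against the ramp returns minus its average over `[a, b]`.
  let w : ℝ → ℝ := (Ioc a b).indicator fun _ => -(b - a)⁻¹
  have hw : MemLp w 2 volI := MemLp.indicator measurableSet_Ioc (memLp_const _)
  have hx : ∀ x ∈ Icc (-1 : ℝ) 1, prim 1 w x = 1 - (b - a)⁻¹ * max (min x b - a) 0 := by
    intro x hx
    rw [prim_eq 1 w hx, intervalIntegral.integral_of_le hx.1,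
      setIntegral_indicator measurableSet_Ioc, Ioc_inter_Ioc, setIntegral_const,
      Real.volume_real_Ioc, smul_eq_mul]
    rw [show (-1 : ℝ) ⊔ a = a from max_eq_right ha]
    ring
  refine ⟨prim 1 w, w, isPrimitive_prim 1 hw, fun x h => ?_, fun x h hxa => ?_, fun x h hbx => ?_,
    fun g => ?_⟩
  · rw [hx x h]
    have h1 : max (min x b - a) 0 ≤ b - a :=
      max_le (by linarith [min_le_right x b]) hba.le
    have h2 : 0 ≤ (b - a)⁻¹ * max (min x b - a) 0 := by positivity
    have h3 : (b - a)⁻¹ * max (min x b - a) 0 ≤ (b - a)⁻¹ * (b - a) := by gcongr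
    rw [inv_mul_cancel₀ hba.ne'] at h3
    constructor <;> linarith
  · rw [hx x h, min_eq_left (by linarith), max_eq_right (by linarith)]
    ring
  · rw [hx x h, min_eq_right hbx, max_eq_left hba.le, inv_mul_cancel₀ hba.ne']
    ring
  · have : ∀ x, g x * w x = (Ioc a b).indicator (fun x => -(b - a)⁻¹ * g x) x := fun x => by
      by_cases hxm : x ∈ Ioc a b
      · simp [w, hxm, mul_comm]
      · simp [w, hxm]
    simp_rw [this]
    rw [integral_I, intervalIntegral.integral_of_le (by norm_num),
      setIntegral_indicator measurableSet_Ioc, Ioc_inter_Ioc, integral_const_mul,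
      show (-1 : ℝ) ⊔ a = a from max_eq_right ha, show (1 : ℝ) ⊓ b = b from min_eq_right hb,
      intervalIntegral.integral_of_le hab.le]
    ring

/-- A monotone function whose increments are dominated by those of a primitive is a primitive,
with a dominated derivative. -/
theorem isPrimitive_deriv_of_monotone {g H h : ℝ → ℝ} (hH : IsPrimitive H h) (hg : Monotone g)
    (hHg : Monotone fun x => H x - g x) :
    IsPrimitive g (deriv g) ∧ 0 ≤ᵐ[volI] deriv g := by
  have le : ∀ x y, dist (g x) (g y) ≤ dist (H x) (H y) := by
    have key : ∀ x y, x ≤ y → dist (g x) (g y) ≤ dist (H x) (H y) := fun x y hxy => by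
      have h1 := hg hxy
      have h2 : H x - g x ≤ H y - g y := hHg hxy
      rw [dist_comm, dist_comm (H x), Real.dist_eq, Real.dist_eq, abs_of_nonneg (by linarith),
        abs_of_nonneg (by linarith)]
      linarith
    intro x y
    rcases le_total x y with hxy | hxy
    · exact key x y hxy
    · rw [dist_comm, dist_comm (H x)]
      exact key y x hxy
  have cont : Continuous g := by
    rw [continuous_iff_continuousAt]
    intro x
    refine tendsto_iff_dist_tendsto_zero.mpr ?_
    exact squeeze_zero (fun _ => dist_nonneg) (fun y => le y x)
      (tendsto_iff_dist_tendsto_zero.mp (hH.cont.tendsto x))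
  have ac : AbsolutelyContinuousOnInterval g (-1) 1 := by
    have h3 := hH.absolutelyContinuousOnInterval
    rw [absolutelyContinuousOnInterval_iff] at h3 ⊢
    intro ε hε
    obtain ⟨δ, hδ, K⟩ := h3 ε hε
    exact ⟨δ, hδ, fun E hE hl => (Finset.sum_le_sum fun i _ => le _ _).trans_lt (K E hE hl)⟩
  have nonneg : ∀ x, 0 ≤ deriv g x := fun x => hg.deriv_nonneg
  refine ⟨⟨?_, cont, fun x hx => ?_⟩, Filter.Eventually.of_forall nonneg⟩
  -- Both `g` and `H - g` are monotone, hence `0 ≤ g' ≤ h` almost everywhere.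
  · refine hH.memLp.mono (measurable_deriv g).aestronglyMeasurable ?_
    filter_upwards [hH.ae_hasDerivAt, ae_restrict_of_ae hg.ae_differentiableAt] with x h1 h2
    have h4 := hHg.deriv_nonneg (x := x)
    rw [(h1.fun_sub h2.hasDerivAt).deriv] at h4
    rw [Real.norm_of_nonneg (nonneg x)]
    exact (sub_nonneg.mp h4).trans (le_abs_self _)
  · have hx1 : uIcc (-1) x ⊆ uIcc (-1 : ℝ) 1 := by
      rw [uIcc_of_le hx.1, uIcc_of_le (by norm_num)]
      exact Icc_subset_Icc le_rfl hx.2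
    rw [(ac.mono hx1).integral_deriv_eq_sub]
    ring

theorem intervalIntegral_mono_ae {f g : ℝ → ℝ} {a b : ℝ} (ha : -1 ≤ a) (hab : a ≤ b) (hb : b ≤ 1)
    (hf : Integrable f volI) (hg : Integrable g volI)
    (h : ∀ᵐ t ∂volI, t ∈ Ioo a b → f t ≤ g t) : ∫ t in a..b, f t ≤ ∫ t in a..b, g t := by
  have hsub : Ioo a b ⊆ I := Ioo_subset_Ioo ha hb
  rw [intervalIntegral.integral_of_le hab, intervalIntegral.integral_of_le hab,
    integral_Ioc_eq_integral_Ioo, integral_Ioc_eq_integral_Ioo]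
  refine setIntegral_mono_on_ae (IntegrableOn.mono_set hf hsub) (IntegrableOn.mono_set hg hsub)
    measurableSet_Ioo ?_
  filter_upwards [ae_volI_iff.mp h] with t ht hm using ht (hsub hm) hm

/-- An essential upper bound of `g` on the left of a zero of `v ≥ 0` is an upper bound of `G`
there, if `v' = G - g`. -/
theorem le_of_contact_left {g v G : ℝ → ℝ} (hG : Continuous G)
    (hv : IsPrimitive v (fun x => G x - g x)) (hv0 : ∀ x ∈ Icc (-1 : ℝ) 1, 0 ≤ v x)
    {x c : ℝ} (hx : x ∈ I) (hvx : v x = 0) (hc : ∀ᵐ r ∂volI, r < x → g r ≤ c) : G x ≤ c := by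
  -- Otherwise `v' ≥ m - c > 0` on some interval `(a, x)`, and `v x = 0` forces `v a < 0`.
  by_contra! hlt
  obtain ⟨m, hcm, hmG⟩ := exists_between hlt
  obtain ⟨δ, hδ, hball⟩ := Metric.eventually_nhds_iff.mp (hG.continuousAt.eventually_const_lt hmG)
  have hax : max (-1) (x - δ / 2) < x := max_lt hx.1 (by linarith)
  have hda : x - δ / 2 ≤ max (-1) (x - δ / 2) := le_max_right _ _
  have ha1 : -1 ≤ max (-1) (x - δ / 2) := le_max_left _ _
  generalize max (-1) (x - δ / 2) = a at hax hda ha1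
  have ha : a ∈ Icc (-1 : ℝ) 1 := ⟨ha1, by linarith [hx.2]⟩
  have e := hv.sub_eq ha ⟨hx.1.le, hx.2.le⟩
  have h1 : ∫ _t in a..x, (m - c) ≤ ∫ t in a..x, (G t - g t) := by
    refine intervalIntegral_mono_ae ha1 hax.le hx.2.le (integrable_const _) hv.integrable ?_
    filter_upwards [hc] with t ht htm
    have h2 : m < G t := hball (by rw [Real.dist_eq, abs_lt]; constructor <;> linarith [htm.1, htm.2])
    linarith [ht htm.2]
  rw [intervalIntegral.integral_const, smul_eq_mul] at h1
  have h3 := hv0 a ha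
  have h4 := mul_pos (sub_pos.mpr hax) (sub_pos.mpr hcm)
  linarith

/-- An essential lower bound of `g` on the right of a zero of `v ≥ 0` is a lower bound of `G`
there, if `v' = G - g`. -/
theorem le_of_contact_right {g v G : ℝ → ℝ} (hG : Continuous G)
    (hv : IsPrimitive v (fun x => G x - g x)) (hv0 : ∀ x ∈ Icc (-1 : ℝ) 1, 0 ≤ v x)
    {x c : ℝ} (hx : x ∈ I) (hvx : v x = 0) (hc : ∀ᵐ r ∂volI, x < r → c ≤ g r) : c ≤ G x := by
  -- Otherwise `v' ≤ m - c < 0` on some interval `(x, b)`, and `v x = 0` forces `v b < 0`.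
  by_contra! hlt
  obtain ⟨m, hGm, hmc⟩ := exists_between hlt
  obtain ⟨δ, hδ, hball⟩ := Metric.eventually_nhds_iff.mp (hG.continuousAt.eventually_lt_const hGm)
  have hxb : x < min 1 (x + δ / 2) := lt_min hx.2 (by linarith)
  have hbd : min 1 (x + δ / 2) ≤ x + δ / 2 := min_le_right _ _
  have hb1 : min 1 (x + δ / 2) ≤ 1 := min_le_left _ _
  generalize min 1 (x + δ / 2) = b at hxb hbd hb1
  have hb : b ∈ Icc (-1 : ℝ) 1 := ⟨by linarith [hx.1], hb1⟩
  have e := hv.sub_eq ⟨hx.1.le, hx.2.le⟩ hb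
  have h1 : ∫ t in x..b, (G t - g t) ≤ ∫ _t in x..b, (m - c) := by
    refine intervalIntegral_mono_ae hx.1.le hxb.le hb1 hv.integrable (integrable_const _) ?_
    filter_upwards [hc] with t ht htm
    have h2 : G t < m := hball (by rw [Real.dist_eq, abs_lt]; constructor <;> linarith [htm.1, htm.2])
    linarith [ht htm.1]
  rw [intervalIntegral.integral_const, smul_eq_mul] at h1
  have h3 := hv0 b hb
  have h4 := mul_pos (sub_pos.mpr hxb) (sub_pos.mpr hmc)
  linarith

/-! ### Regularity and complementarity in the obstacle problem -/

/-- `∫ g Q' ≥ 0` for every `Q ∈ H¹(I; 1)` with `Q ≤ v`. -/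
def NonnegBelow (g v : ℝ → ℝ) : Prop :=
  ∀ Q w : ℝ → ℝ, IsPrimitive Q w → Q 1 = 0 → (∀ x ∈ Icc (-1 : ℝ) 1, Q x ≤ v x) →
    0 ≤ ∫ x in I, g x * w x

namespace NonnegBelow

variable {g v : ℝ → ℝ}

/-- The competitor is minus a ramp, which lies below `0 ≤ v`. -/
theorem integral_nonneg (H : NonnegBelow g v) (hv0 : ∀ x ∈ Icc (-1 : ℝ) 1, 0 ≤ v x)
    {a b : ℝ} (ha : -1 ≤ a) (hab : a < b) (hb : b ≤ 1) : 0 ≤ ∫ x in a..b, g x := by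
  obtain ⟨R, w, hR, h01, -, h0, hint⟩ := exists_ramp ha hab hb
  have := H _ _ (hR.const_mul (-1)) (by simp [h0 1 (by simp) hb])
    fun x hx => by linarith [hv0 x hx, (h01 x hx).1]
  have e : ∀ x, g x * (-1 * w x) = -(g x * w x) := fun x => by ring
  simp_rw [e] at this
  rw [integral_neg, hint, neg_neg] at this
  exact nonneg_of_mul_nonneg_right this (inv_pos.mpr (sub_pos.mpr hab))

/-- The competitor is the ramp falling on `[a, a + h]` minus the one falling on `[b - h, b]`. The
former drops first, so the difference is nonpositive. -/
theorem integral_mono (H : NonnegBelow g v) (hg : MemLp g 2 volI)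
    (hv0 : ∀ x ∈ Icc (-1 : ℝ) 1, 0 ≤ v x) {a b h : ℝ} (ha : -1 ≤ a) (h0 : 0 < h)
    (hab : a + h ≤ b - h) (hb : b ≤ 1) :
    ∫ x in a..(a + h), g x ≤ ∫ x in (b - h)..b, g x := by
  obtain ⟨R, w, hR, hR01, hR1, hR0, hRint⟩ :=
    exists_ramp ha (show a < a + h by linarith) (by linarith)
  obtain ⟨R', w', hR', hR01', hR1', hR0', hRint'⟩ :=
    exists_ramp (show -1 ≤ b - h by linarith) (show b - h < b by linarith) hb
  have := H _ _ (hR.sub hR') (by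
    simp [hR0 1 (by simp) (by linarith), hR0' 1 (by simp) (by linarith)]) fun x hx => by
      have := hv0 x hx
      rcases le_total x (b - h) with hxb | hxb
      · linarith [hR1' x hx hxb, (hR01 x hx).2]
      · linarith [hR0 x hx (by linarith), (hR01' x hx).1]
  simp_rw [mul_sub] at this
  rw [integral_I_sub (integrable_mul_of_memLp hg hR.memLp) (integrable_mul_of_memLp hg hR'.memLp),
    hRint, hRint', show a + h - a = h by ring, show b - (b - h) = h by ring] at this
  refine le_of_mul_le_mul_left ?_ (inv_pos.mpr h0)
  linarith

/-- The opposite difference of ramps is at most one and vanishes off `[a, b]`. Scaled by the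
positive minimum of `v` on `[a, b]`, it stays below `v`, so the inequality of `integral_mono`
reverses. -/
theorem integral_mono_of_pos (H : NonnegBelow g v) (hg : MemLp g 2 volI)
    (hv0 : ∀ x ∈ Icc (-1 : ℝ) 1, 0 ≤ v x) (hvc : Continuous v) {a b h : ℝ} (ha : -1 ≤ a)
    (h0 : 0 < h) (hab : a + h ≤ b - h) (hb : b ≤ 1) (hpos : ∀ x ∈ Icc a b, 0 < v x) :
    ∫ x in (b - h)..b, g x ≤ ∫ x in a..(a + h), g x := by
  obtain ⟨R, w, hR, hR01, hR1, hR0, hRint⟩ :=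
    exists_ramp ha (show a < a + h by linarith) (by linarith)
  obtain ⟨R', w', hR', hR01', hR1', hR0', hRint'⟩ :=
    exists_ramp (show -1 ≤ b - h by linarith) (show b - h < b by linarith) hb
  obtain ⟨x₀, hx₀, hmin⟩ := isCompact_Icc.exists_isMinOn
    (nonempty_Icc.mpr (show a ≤ b by linarith)) hvc.continuousOn
  have hδ := hpos x₀ hx₀
  have := H _ _ ((hR'.sub hR).const_mul (v x₀)) (by
    simp [hR0 1 (by simp) (by linarith), hR0' 1 (by simp) (by linarith)]) fun x hx => by
      by_cases hxm : x ∈ Icc a b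
      · refine le_trans ?_ (hmin hxm)
        exact mul_le_of_le_one_right hδ.le (by linarith [(hR01 x hx).1, (hR01' x hx).2])
      · have : R' x - R x = 0 := by
          rcases lt_or_ge x a with hxa | hxa
          · rw [hR1 x hx hxa.le, hR1' x hx (by linarith), sub_self]
          · have hxb : b < x := not_le.mp fun h' => hxm ⟨hxa, h'⟩
            rw [hR0 x hx (by linarith), hR0' x hx hxb.le, sub_self]
        rw [this, mul_zero]
        exact hv0 x hx
  have e : ∀ x, g x * (v x₀ * (w' x - w x)) = v x₀ * (g x * w' x - g x * w x) := fun x => by ring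
  simp_rw [e] at this
  rw [integral_const_mul, integral_I_sub (integrable_mul_of_memLp hg hR'.memLp)
    (integrable_mul_of_memLp hg hR.memLp),
    hRint, hRint', show a + h - a = h by ring, show b - (b - h) = h by ring] at this
  have := nonneg_of_mul_nonneg_right this hδ
  refine le_of_mul_le_mul_left ?_ (inv_pos.mpr h0)
  linarith

end NonnegBelow

/-- The points of `I` at which the primitive of `g` has derivative `g`. -/
def lebesgueSet (g : ℝ → ℝ) : Set ℝ := {x | x ∈ I ∧ HasDerivAt (prim 0 g) (g x) x}

theorem ae_mem_lebesgueSet {g : ℝ → ℝ} (hg : MemLp g 2 volI) :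
    ∀ᵐ x ∂volI, x ∈ lebesgueSet g := by
  filter_upwards [ae_volI_mem, (isPrimitive_prim 0 hg).ae_hasDerivAt] with x h1 h2
  exact ⟨h1, h2⟩

open Filter Topology in
-- One-sided averages turn the integral comparisons, whose intervals lie between the two points
-- compared, into comparisons of point values.
theorem tendsto_average_right {g : ℝ → ℝ} (hg : MemLp g 2 volI) {s : ℝ}
    (hs : s ∈ lebesgueSet g) :
    Tendsto (fun h => h⁻¹ * ∫ x in s..(s + h), g x) (𝓝[>] 0) (𝓝 (g s)) := by
  have h1 := (hasDerivAt_iff_tendsto_slope_zero.mp hs.2).mono_left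
    (nhdsWithin_mono 0 (show Ioi (0 : ℝ) ⊆ {0}ᶜ from fun x (hx : 0 < x) => hx.ne'))
  refine h1.congr' ?_
  filter_upwards [Ioo_mem_nhdsGT (show (0 : ℝ) < 1 - s by linarith [hs.1.2])] with h hh
  rw [smul_eq_mul, (isPrimitive_prim 0 hg).sub_eq ⟨hs.1.1.le, hs.1.2.le⟩
    ⟨by linarith [hs.1.1, hh.1], by linarith [hh.2]⟩]

open Filter Topology in
theorem tendsto_average_left {g : ℝ → ℝ} (hg : MemLp g 2 volI) {s : ℝ}
    (hs : s ∈ lebesgueSet g) :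
    Tendsto (fun h => h⁻¹ * ∫ x in (s - h)..s, g x) (𝓝[>] 0) (𝓝 (g s)) := by
  have h0 : Tendsto (fun h : ℝ => -h) (𝓝[>] 0) (𝓝[≠] 0) := by
    refine tendsto_nhdsWithin_iff.mpr ⟨?_, ?_⟩
    · have : Tendsto (fun h : ℝ => -h) (𝓝 0) (𝓝 (-0)) := tendsto_id.neg
      rw [neg_zero] at this
      exact this.mono_left nhdsWithin_le_nhds
    · filter_upwards [self_mem_nhdsWithin] with h hh
      exact neg_ne_zero.mpr (ne_of_gt hh)
  have h1 := (hasDerivAt_iff_tendsto_slope_zero.mp hs.2).comp h0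
  refine h1.congr' ?_
  filter_upwards [Ioo_mem_nhdsGT (show (0 : ℝ) < s - (-1) by linarith [hs.1.1])] with h hh
  have e := (isPrimitive_prim 0 hg).sub_eq (a := s - h) (b := s)
    ⟨by linarith [hh.2], by linarith [hs.1.2, hh.1]⟩ ⟨hs.1.1.le, hs.1.2.le⟩
  simp only [Function.comp, smul_eq_mul]
  rw [← e, inv_neg, ← sub_eq_add_neg]
  ring

namespace NonnegBelow

variable {g v : ℝ → ℝ}

open Filter Topology in
theorem nonneg_of_mem (H : NonnegBelow g v) (hg : MemLp g 2 volI)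
    (hv0 : ∀ x ∈ Icc (-1 : ℝ) 1, 0 ≤ v x) {s : ℝ} (hs : s ∈ lebesgueSet g) : 0 ≤ g s := by
  refine ge_of_tendsto (tendsto_average_right hg hs) ?_
  filter_upwards [Ioo_mem_nhdsGT (show (0 : ℝ) < 1 - s by linarith [hs.1.2])] with h hh
  exact mul_nonneg (inv_nonneg.mpr hh.1.le)
    (H.integral_nonneg hv0 hs.1.1.le (by linarith [hh.1]) (by linarith [hh.2]))

open Filter Topology in
theorem mono_of_mem (H : NonnegBelow g v) (hg : MemLp g 2 volI)
    (hv0 : ∀ x ∈ Icc (-1 : ℝ) 1, 0 ≤ v x) {s t : ℝ} (hs : s ∈ lebesgueSet g)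
    (ht : t ∈ lebesgueSet g) (hst : s ≤ t) : g s ≤ g t := by
  rcases hst.eq_or_lt with rfl | hst
  · exact le_rfl
  refine le_of_tendsto_of_tendsto (tendsto_average_right hg hs) (tendsto_average_left hg ht) ?_
  filter_upwards [Ioo_mem_nhdsGT (show (0 : ℝ) < (t - s) / 2 by linarith)] with h hh
  exact mul_le_mul_of_nonneg_left (H.integral_mono hg hv0 hs.1.1.le hh.1 (by linarith [hh.2])
    ht.1.2.le) (inv_nonneg.mpr hh.1.le)

open Filter Topology in
theorem eq_of_mem_of_pos (H : NonnegBelow g v) (hg : MemLp g 2 volI)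
    (hv0 : ∀ x ∈ Icc (-1 : ℝ) 1, 0 ≤ v x) (hvc : Continuous v) {s t : ℝ}
    (hs : s ∈ lebesgueSet g) (ht : t ∈ lebesgueSet g) (hst : s ≤ t)
    (hpos : ∀ x ∈ Icc s t, 0 < v x) : g s = g t := by
  refine le_antisymm (H.mono_of_mem hg hv0 hs ht hst) ?_
  rcases hst.eq_or_lt with rfl | hst
  · exact le_rfl
  refine le_of_tendsto_of_tendsto (tendsto_average_left hg ht) (tendsto_average_right hg hs) ?_
  filter_upwards [Ioo_mem_nhdsGT (show (0 : ℝ) < (t - s) / 2 by linarith)] with h hh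
  exact mul_le_mul_of_nonneg_left (H.integral_mono_of_pos hg hv0 hvc hs.1.1.le hh.1
    (by linarith [hh.2]) ht.1.2.le hpos) (inv_nonneg.mpr hh.1.le)

/-- The increments of `g` are bounded by the variation of `G`. -/
theorem sub_le_integral_abs (H : NonnegBelow g v) (hg : MemLp g 2 volI)
    (hv0 : ∀ x ∈ Icc (-1 : ℝ) 1, 0 ≤ v x) {G G' : ℝ → ℝ} (hG : IsPrimitive G G')
    (hv : IsPrimitive v (fun x => G x - g x)) {s t : ℝ}
    (hs : s ∈ lebesgueSet g) (ht : t ∈ lebesgueSet g) (hst : s ≤ t) :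
    g t - g s ≤ ∫ x in s..t, |G' x| := by
  have hint : 0 ≤ ∫ x in s..t, |G' x| :=
    intervalIntegral.integral_nonneg hst fun x _ => abs_nonneg _
  rcases (Icc s t ∩ v ⁻¹' {0}).eq_empty_or_nonempty with he | hne
  · rw [H.eq_of_mem_of_pos hg hv0 hv.cont hs ht hst fun x hx => ?_, sub_self]
    · exact hint
    · refine lt_of_le_of_ne (hv0 x ⟨by linarith [hs.1.1, hx.1], by linarith [ht.1.2, hx.2]⟩) ?_
      intro h0
      have : x ∈ Icc s t ∩ v ⁻¹' {0} := ⟨hx, h0.symm⟩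
      simp [he] at this
  have hK : IsCompact (Icc s t ∩ v ⁻¹' {0}) :=
    isCompact_Icc.inter_right (isClosed_singleton.preimage hv.cont)
  -- `a` and `b` are the first and the last contact point in `[s, t]`; `g` is constant on the
  -- Lebesgue points of `[s, a)` and of `(b, t]`.
  obtain ⟨a, ⟨⟨hsa, hat⟩, hva⟩, hamin⟩ := hK.exists_isLeast hne
  obtain ⟨b, ⟨⟨hsb, hbt⟩, hvb⟩, hbmax⟩ := hK.exists_isGreatest hne
  have hab : a ≤ b := hamin ⟨⟨hsb, hbt⟩, hvb⟩
  have haI : a ∈ I := ⟨by linarith [hs.1.1], by linarith [ht.1.2]⟩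
  have hbI : b ∈ I := ⟨by linarith [hs.1.1], by linarith [ht.1.2]⟩
  have pos : ∀ x ∈ Icc s t, v x ≠ 0 → 0 < v x := fun x hx hne =>
    lt_of_le_of_ne (hv0 x ⟨by linarith [hs.1.1, hx.1], by linarith [ht.1.2, hx.2]⟩) hne.symm
  -- To the left of `a`, `g` is almost everywhere at most `g s`: by monotonicity before `s`, by
  -- constancy after it.
  have h1 : G a ≤ g s := by
    refine le_of_contact_left hG.cont hv hv0 haI hva ?_
    filter_upwards [ae_mem_lebesgueSet hg] with r hr hra
    rcases le_total r s with hrs | hsr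
    · exact H.mono_of_mem hg hv0 hr hs hrs
    · refine (H.eq_of_mem_of_pos hg hv0 hv.cont hs hr hsr fun x hx => ?_).ge
      have hx' : x ∈ Icc s t := ⟨hx.1, by linarith [hx.2]⟩
      refine pos x hx' fun h0 => ?_
      linarith [hamin ⟨hx', h0⟩, hx.2]
  have h2 : g t ≤ G b := by
    refine le_of_contact_right hG.cont hv hv0 hbI hvb ?_
    filter_upwards [ae_mem_lebesgueSet hg] with r hr hbr
    rcases le_total t r with htr | hrt
    · exact H.mono_of_mem hg hv0 ht hr htr
    · refine (H.eq_of_mem_of_pos hg hv0 hv.cont hr ht hrt fun x hx => ?_).ge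
      have hx' : x ∈ Icc s t := ⟨by linarith [hx.1], hx.2⟩
      refine pos x hx' fun h0 => ?_
      linarith [hbmax ⟨hx', h0⟩, hx.1]
  have h3 : G b - G a ≤ ∫ x in a..b, |G' x| := by
    rw [hG.sub_eq ⟨haI.1.le, haI.2.le⟩ ⟨hbI.1.le, hbI.2.le⟩]
    exact (le_abs_self _).trans (intervalIntegral.abs_integral_le_integral_abs hab)
  have h4 : ∫ x in a..b, |G' x| ≤ ∫ x in s..t, |G' x| := by
    refine intervalIntegral.integral_mono_interval hsa hab hbt
      (Filter.Eventually.of_forall fun x => abs_nonneg _) ?_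
    exact (intervalIntegrable_of_integrable hG.integrable ⟨hs.1.1.le, hs.1.2.le⟩
      ⟨ht.1.1.le, ht.1.2.le⟩).abs
  linarith

/-- Regularity in the obstacle problem: `g` is a nondecreasing function in `H¹(I)`. -/
theorem exists_isPrimitive (H : NonnegBelow g v) (hg : MemLp g 2 volI)
    (hv0 : ∀ x ∈ Icc (-1 : ℝ) 1, 0 ≤ v x) {G G' : ℝ → ℝ} (hG : IsPrimitive G G')
    (hv : IsPrimitive v (fun x => G x - g x)) :
    ∃ g₁ ρ : ℝ → ℝ, IsPrimitive g₁ ρ ∧ g =ᵐ[volI] g₁ ∧ 0 ≤ᵐ[volI] ρ ∧ 0 ≤ g₁ (-1) := by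
  have hA : MemLp (fun x => |G' x|) 2 volI := hG.memLp.norm
  set V := prim 0 fun x => |G' x| with hV
  have hVp : IsPrimitive V fun x => |G' x| := isPrimitive_prim 0 hA
  have hVmono : Monotone V := by
    intro x y hxy
    have hi : Integrable (I.indicator fun x => |G' x|) volume :=
      (integrable_indicator_iff measurableSet_I).mpr (integrable_of_memLp hA)
    have e := intervalIntegral.integral_interval_sub_left (hi.intervalIntegrable (a := -1) (b := y))
      (hi.intervalIntegrable (a := -1) (b := x))
    have h0 : 0 ≤ ∫ t in x..y, I.indicator (fun x => |G' x|) t :=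
      intervalIntegral.integral_nonneg hxy fun t _ => indicator_nonneg (fun _ _ => abs_nonneg _) t
    simp only [hV, prim]
    linarith
  obtain ⟨s₀, hs₀⟩ : (lebesgueSet g).Nonempty := by
    have : NeZero volI := ⟨by simp [volI, I, Measure.restrict_eq_zero]⟩
    exact (ae_mem_lebesgueSet hg).exists
  have : Nonempty (lebesgueSet g) := ⟨⟨s₀, hs₀⟩⟩
  -- Extension by infimal convolution. The infimum over `s` is nonnegative and nondecreasing, with
  -- increments at most those of `V`. It equals `g` at a Lebesgue point `x`: terms with `s ≥ x` are
  -- controlled by monotonicity, those with `s ≤ x` by the increment bound.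
  let F : ℝ → lebesgueSet g → ℝ := fun x s => g s + max (V x - V s) 0
  have hF0 : ∀ x s, 0 ≤ F x s := fun x s =>
    add_nonneg (H.nonneg_of_mem hg hv0 s.2) (le_max_right _ _)
  have hbdd : ∀ x, BddBelow (range (F x)) := fun x => ⟨0, by
    rintro _ ⟨s, rfl⟩
    exact hF0 x s⟩
  let g₁ : ℝ → ℝ := fun x => ⨅ s, F x s
  have hm1 : Monotone g₁ := fun x y hxy => ciInf_mono (hbdd x) fun s => by
    have := hVmono hxy
    simp only [F]
    gcongr
  have hm2 : Monotone fun x => V x - g₁ x := fun x y hxy => by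
    have hle : g₁ y - (V y - V x) ≤ g₁ x := le_ciInf fun s => by
      have h1 : g₁ y ≤ F y s := ciInf_le (hbdd y) s
      have h2 := hVmono hxy
      have h3 : max (V y - V s) 0 ≤ max (V x - V s) 0 + (V y - V x) :=
        max_le (by linarith [le_max_left (V x - V s) 0]) (by linarith [le_max_right (V x - V s) 0])
      simp only [F] at h1 ⊢
      linarith
    change V x - g₁ x ≤ V y - g₁ y
    linarith
  have heq : ∀ x ∈ lebesgueSet g, g₁ x = g x := fun x hx => by
    refine le_antisymm ?_ (le_ciInf fun s => ?_)
    · have : g₁ x ≤ F x ⟨x, hx⟩ := ciInf_le (hbdd x) _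
      simpa [F] using this
    · simp only [F]
      rcases le_total x s with hxs | hsx
      · linarith [H.mono_of_mem hg hv0 hx s.2 hxs, le_max_right (V x - V s) 0]
      · have h1 := H.sub_le_integral_abs hg hv0 hG hv s.2 hx hsx
        rw [← hVp.sub_eq ⟨s.2.1.1.le, s.2.1.2.le⟩ ⟨hx.1.1.le, hx.1.2.le⟩] at h1
        linarith [le_max_left (V x - V s) 0]
  obtain ⟨p1, p2⟩ := isPrimitive_deriv_of_monotone hVp hm1 hm2
  refine ⟨g₁, deriv g₁, p1, ?_, p2, le_ciInf fun s => hF0 _ s⟩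
  filter_upwards [ae_mem_lebesgueSet hg] with x hx using (heq x hx).symm

/-- Complementarity in the obstacle problem. -/
theorem complementarity (H : NonnegBelow g v) (hv0 : ∀ x ∈ Icc (-1 : ℝ) 1, 0 ≤ v x)
    {v' g₁ ρ : ℝ → ℝ} (hv : IsPrimitive v v') (hg₁ : IsPrimitive g₁ ρ) (hg : g =ᵐ[volI] g₁)
    (hρ : 0 ≤ᵐ[volI] ρ) (hγ : 0 ≤ g₁ (-1)) :
    (∀ᵐ x ∂volI, ρ x * v x = 0) ∧ g₁ (-1) * v (-1) = 0 := by
  -- The weight vanishes at `1`, where `v` need not, equals one at `-1`, and is positive on `I`.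
  -- Both `θ v` and `-θ v` lie below `v`, so the inequality becomes an equality.
  have hθ : IsPrimitive (fun x : ℝ => (1 - x) / 2) (fun _ => -1 / 2) :=
    .of_hasDerivAt (fun x => ((hasDerivAt_id x).const_sub 1).div_const 2) continuous_const
  have hQ := hθ.mul hv
  have h1 := H _ _ hQ (by simp) fun x hx =>
    mul_le_of_le_one_left (hv0 x hx) (by linarith [hx.1])
  have h2 := H _ _ (hQ.const_mul (-1)) (by simp) fun x hx => by
    have := mul_nonneg (show 0 ≤ (1 - x) / 2 by linarith [hx.2]) (hv0 x hx)
    linarith [hv0 x hx]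
  have e : ∀ x u : ℝ, g x * (-1 * u) = -(g x * u) := fun x u => by ring
  simp_rw [e] at h2
  rw [integral_neg] at h2
  have e1 := hg₁.integral_mul_add hQ
  have e2 : ∫ x in I, g₁ x * (-1 / 2 * v x + (1 - x) / 2 * v' x) =
      ∫ x in I, g x * (-1 / 2 * v x + (1 - x) / 2 * v' x) := by
    refine integral_I_congr ?_
    filter_upwards [hg] with x hx
    rw [hx]
  rw [e2] at e1
  have e3 : g₁ 1 * ((1 - 1) / 2 * v 1) - g₁ (-1) * ((1 - -1) / 2 * v (-1)) =
      -(g₁ (-1) * v (-1)) := by ring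
  rw [e3] at e1
  have pos : 0 ≤ᵐ[volI] fun x => ρ x * ((1 - x) / 2 * v x) := by
    filter_upwards [hρ, ae_volI_mem] with x h1 hx
    exact mul_nonneg h1 (mul_nonneg (by linarith [hx.2]) (hv0 x ⟨hx.1.le, hx.2.le⟩))
  have h3 : 0 ≤ ∫ x in I, ρ x * ((1 - x) / 2 * v x) := integral_nonneg_of_ae pos
  have h4 : 0 ≤ g₁ (-1) * v (-1) := mul_nonneg hγ (hv0 _ (by simp))
  refine ⟨?_, by linarith⟩
  have h5 : ∫ x in I, ρ x * ((1 - x) / 2 * v x) = 0 := by linarith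
  have h6 := (integral_eq_zero_iff_of_nonneg_ae pos
    (integrable_mul_of_memLp hg₁.memLp hQ.memLp_self)).mp h5
  filter_upwards [h6, ae_volI_mem] with x h7 hx
  have h8 : ρ x * ((1 - x) / 2 * v x) = 0 := h7
  have h9 : (1 - x) / 2 ≠ 0 := ne_of_gt (by linarith [hx.2])
  rcases mul_eq_zero.mp h8 with h | h
  · rw [h, zero_mul]
  · rw [(mul_eq_zero.mp h).resolve_left h9, mul_zero]

end NonnegBelow

/-! ### Optimality and the variational inequality -/

theorem combination_of_memH {u v : ℝ → ℝ} (hu : MemH 1 u) (hv : MemH 1 v) (t : ℝ) :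
    ∃ V, IsPrimitive V (fun x => wd u x + t * (wd v x - wd u x)) ∧
      (fun x => u x + t * (v x - u x)) =ᵐ[volI] V ∧
      ∀ x, V x = rep u x + t * (rep v x - rep u x) := by
  obtain ⟨hu1, hu2⟩ := hu.isPrimitive_rep
  obtain ⟨hv1, hv2⟩ := hv.isPrimitive_rep
  refine ⟨_, hu1.add ((hv1.sub hu1).const_mul t), ?_, fun x => rfl⟩
  filter_upwards [hu2, hv2] with x h1 h2
  rw [h1, h2]

/-- Affine combinations in `V`. -/
theorem MemV.combination {y z : ℝ → ℝ} (hy : MemV y) (hz : MemV z) (t : ℝ) :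
    MemV (fun x => y x + t * (z x - y x)) ∧
    wd (fun x => y x + t * (z x - y x)) =ᵐ[volI] (fun x => wd y x + t * (wd z x - wd y x)) ∧
    wd (wd (fun x => y x + t * (z x - y x))) =ᵐ[volI]
      (fun x => wd (wd y) x + t * (wd (wd z) x - wd (wd y) x)) := by
  obtain ⟨V, hV, eV, rV⟩ := combination_of_memH hy.1.of_succ hz.1.of_succ t
  obtain ⟨W, hW, eW, rW⟩ := combination_of_memH hy.1.wd hz.1.wd t
  have e1 := hV.wd_ae_eq eV
  have m1 : (-1 : ℝ) ∈ Icc (-1 : ℝ) 1 := by simp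
  have m2 : (1 : ℝ) ∈ Icc (-1 : ℝ) 1 := by simp
  refine ⟨⟨hV.memH (hW.memH (k := 0) hW.memLp eW) eV, ?_, ?_⟩, e1, hW.wd_ae_eq (e1.trans eW)⟩
  · rw [hV.rep_eqOn eV m1, rV, hy.2.1, hz.2.1]
    ring
  · rw [hW.rep_eqOn (e1.trans eW) m2, rW, hy.2.2, hz.2.2]
    ring

theorem MemK.combination {ψ y z : ℝ → ℝ} (hy : MemK ψ y) (hz : MemK ψ z) {t : ℝ} (h0 : 0 ≤ t)
    (h1 : t ≤ 1) : MemK ψ (fun x => y x + t * (z x - y x)) := by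
  obtain ⟨hV, e, -⟩ := hy.1.combination hz.1 t
  refine ⟨hV, ?_⟩
  filter_upwards [e, hy.2, hz.2] with x h2 h3 h4
  rw [h2]
  nlinarith

theorem integral_sq_add {c d : ℝ → ℝ} (hc : MemLp c 2 volI) (hd : MemLp d 2 volI) (t : ℝ) :
    ∫ x in I, (c x + t * d x) ^ 2 =
      (∫ x in I, c x ^ 2) + 2 * t * (∫ x in I, c x * d x) + t ^ 2 * ∫ x in I, d x ^ 2 := by
  have e : ∀ x, (c x + t * d x) ^ 2 = c x * c x + 2 * t * (c x * d x) + t ^ 2 * (d x * d x) :=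
    fun x => by ring
  have icc := integrable_mul_of_memLp hc hc
  have icd := (integrable_mul_of_memLp hc hd).const_mul (2 * t)
  have idd := (integrable_mul_of_memLp hd hd).const_mul (t ^ 2)
  simp_rw [e, sq (c _), sq (d _)]
  rw [integral_I_add (f := fun x => c x * c x + 2 * t * (c x * d x)) (icc.add icd) idd,
    integral_I_add icc icd, integral_const_mul, integral_const_mul]

theorem Admissible.memK {f ψ y u : ℝ → ℝ} (h : Admissible f ψ y u) : MemK ψ y :=
  ⟨⟨h.state_mem, h.left_bc, h.right_bc⟩, h.constraint⟩

theorem MemK.admissible {f ψ y : ℝ → ℝ} (hf : MemH 1 f) (h : MemK ψ y) :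
    Admissible f ψ y (fun x => -(wd (wd y) x + f x)) where
  state_mem := h.1.1
  control_mem := (h.1.1.wd.wd.memLp.add hf.memLp).neg
  state_eq := Filter.Eventually.of_forall fun x => by ring
  constraint := h.2
  left_bc := h.1.2.1
  right_bc := h.1.2.2

/-- The cost of a state with its only admissible control. -/
def reducedCost (β : ℝ) (yd f y : ℝ → ℝ) : ℝ := J β yd y fun x => -(wd (wd y) x + f x)

theorem Admissible.cost_eq {β : ℝ} {yd f ψ y u : ℝ → ℝ} (h : Admissible f ψ y u) :
    J β yd y u = reducedCost β yd f y := by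
  have : ∫ x in I, u x ^ 2 = ∫ x in I, (-(wd (wd y) x + f x)) ^ 2 := by
    refine integral_I_congr ?_
    filter_upwards [h.state_eq] with x hx
    rw [show u x = -(wd (wd y) x + f x) by linarith]
  simp only [reducedCost, J, this]

/-- The derivative of the reduced cost at `y` in the direction of `z - y`. -/
def costDerivative (β : ℝ) (yd f y z : ℝ → ℝ) : ℝ :=
  (∫ x in I, (y x - yd x) * (z x - y x)) +
    β * ∫ x in I, (wd (wd y) x + f x) * (wd (wd z) x - wd (wd y) x)

/-- The exact quadratic expansion along a segment: the linear coefficient is the left side of the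
variational inequality, and for `β ≥ 0` the quadratic one is nonnegative. -/
theorem reducedCost_combination (β : ℝ) {yd f y z : ℝ → ℝ} (hyd : MemL2 yd) (hf : MemH 1 f)
    (hy : MemV y) (hz : MemV z) (t : ℝ) :
    reducedCost β yd f (fun x => y x + t * (z x - y x)) =
      reducedCost β yd f y + t * costDerivative β yd f y z +
        t ^ 2 / 2 * ((∫ x in I, (z x - y x) ^ 2) +
          β * ∫ x in I, (wd (wd z) x - wd (wd y) x) ^ 2) := by
  obtain ⟨-, -, e⟩ := hy.combination hz t
  have e1 : ∫ x in I, (-(wd (wd (fun x => y x + t * (z x - y x))) x + f x)) ^ 2 =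
      ∫ x in I, ((wd (wd y) x + f x) + t * (wd (wd z) x - wd (wd y) x)) ^ 2 := by
    refine integral_I_congr ?_
    filter_upwards [e] with x hx
    rw [hx]
    ring
  have e2 : ∀ x, (y x + t * (z x - y x) - yd x) ^ 2 = ((y x - yd x) + t * (z x - y x)) ^ 2 :=
    fun x => by ring
  have e3 : ∀ x, (-(wd (wd y) x + f x)) ^ 2 = (wd (wd y) x + f x) ^ 2 := fun x => by ring
  have ly := hy.1.memLp
  have lyd : MemLp yd 2 volI := hyd
  simp only [reducedCost, costDerivative, J]
  rw [e1]
  simp_rw [e2, e3]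
  rw [integral_sq_add (c := fun x => y x - yd x) (d := fun x => z x - y x)
      (ly.sub lyd) (hz.1.memLp.sub ly),
    integral_sq_add (c := fun x => wd (wd y) x + f x) (d := fun x => wd (wd z) x - wd (wd y) x)
      (hy.1.wd.wd.memLp.add hf.memLp) (hz.1.wd.wd.memLp.sub hy.1.wd.wd.memLp)]
  ring

theorem isOptimalState_iff_solvesVI {β : ℝ} (hβ : 0 < β) {yd f ψ : ℝ → ℝ} (hyd : MemL2 yd)
    (hf : MemH 1 f) (y : ℝ → ℝ) : IsOptimalState β yd f ψ y ↔ SolvesVI β yd f ψ y := by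
  have nonneg : ∀ z, 0 ≤ (∫ x in I, (z x - y x) ^ 2) +
      β * ∫ x in I, (wd (wd z) x - wd (wd y) x) ^ 2 := fun z =>
    add_nonneg (integral_nonneg fun x => sq_nonneg _)
      (mul_nonneg hβ.le (integral_nonneg fun x => sq_nonneg _))
  constructor
  · rintro ⟨u, had, hmin⟩
    refine ⟨had.memK, fun z hz => ?_⟩
    change 0 ≤ costDerivative β yd f y z
    by_contra! hneg
    have hB := nonneg z
    have key : ∀ t, 0 ≤ t → t ≤ 1 → reducedCost β yd f y ≤
        reducedCost β yd f (fun x => y x + t * (z x - y x)) := fun t h0 h1 => by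
      have hk := (had.memK.combination hz h0 h1).admissible hf
      have := hmin _ _ hk
      rwa [had.cost_eq, hk.cost_eq] at this
    simp_rw [reducedCost_combination β hyd hf had.memK.1 hz.1] at key
    generalize costDerivative β yd f y z = A at hneg key
    generalize (∫ x in I, (z x - y x) ^ 2) +
      β * ∫ x in I, (wd (wd z) x - wd (wd y) x) ^ 2 = B at hB key
    -- With `A < 0 ≤ B`, the step `t = -A / (B - A)` lies in `(0, 1]` and `A + t B / 2 = (1 + t) A /
    -- 2 < 0`, so the cost would decrease.
    have hpos : 0 < B - A := by linarith
    have ht0 : 0 < -A / (B - A) := div_pos (by linarith) hpos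
    have ht1 : -A / (B - A) ≤ 1 := (div_le_one hpos).mpr (by linarith)
    have hk := key _ ht0.le ht1
    have hmul : -A / (B - A) * (B - A) = -A := div_mul_cancel₀ _ hpos.ne'
    generalize -A / (B - A) = t at ht0 ht1 hk hmul
    have h2 : 0 ≤ t * (A + t * B / 2) := by linarith
    have h3 := nonneg_of_mul_nonneg_right h2 ht0
    nlinarith
  · rintro ⟨hK, hvi⟩
    refine ⟨_, hK.admissible hf, fun z v hz => ?_⟩
    rw [hz.cost_eq, (hK.admissible hf).cost_eq]
    have h1 := reducedCost_combination β hyd hf hK.1 hz.memK.1 1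
    have e : (fun x => y x + 1 * (z x - y x)) = z := funext fun x => by ring
    rw [e] at h1
    have h2 : 0 ≤ costDerivative β yd f y z := hvi z hz.memK
    linarith [nonneg z]

/-! ### The measure `β (ρ dx + γ δ₋₁)` -/

section StructuredMeasure

variable {β γ : ℝ} {ρ : ℝ → ℝ}

theorem isFiniteMeasure_structuredMeasure (hρ : MemL2 ρ) :
    IsFiniteMeasure (structuredMeasure β ρ γ) := by
  have : IsFiniteMeasure (volI.withDensity fun x => ENNReal.ofReal (ρ x)) :=
    isFiniteMeasure_withDensity_ofReal (integrable_of_memLp hρ).2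
  have : IsFiniteMeasure (ENNReal.ofReal γ • Measure.dirac (-1 : ℝ)) :=
    Measure.smul_finite _ ENNReal.ofReal_ne_top
  exact Measure.smul_finite _ ENNReal.ofReal_ne_top

theorem structuredMeasure_compl_Ico : structuredMeasure β ρ γ (Ico (-1) 1)ᶜ = 0 := by
  have h1 : volI (Ico (-1) 1)ᶜ = 0 := by
    rw [volI, Measure.restrict_apply measurableSet_Ico.compl]
    convert measure_empty (μ := (volume : Measure ℝ))
    ext x
    simp only [I, mem_inter_iff, mem_compl_iff, mem_Ico, mem_Ioo, mem_empty_iff_false, iff_false]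
    rintro ⟨h, h2⟩
    exact h ⟨h2.1.le, h2.2⟩
  have h2 : (volI.withDensity fun x => ENNReal.ofReal (ρ x)) (Ico (-1) 1)ᶜ = 0 :=
    withDensity_absolutelyContinuous _ _ h1
  simp [structuredMeasure, h2]

theorem integral_structuredMeasure (hβ : 0 ≤ β) (hγ : 0 ≤ γ) (hρ : MemL2 ρ)
    (hρ0 : 0 ≤ᵐ[volI] ρ) {h : ℝ → ℝ} (hh : Continuous h) :
    ∫ x in Icc (-1) 1, h x ∂(structuredMeasure β ρ γ) =
      β * ((∫ x in I, ρ x * h x) + γ * h (-1)) := by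
  have hr : (structuredMeasure β ρ γ).restrict (Icc (-1) 1) = structuredMeasure β ρ γ := by
    refine Measure.restrict_eq_self_of_ae_mem ?_
    rw [ae_iff]
    exact measure_mono_null (compl_subset_compl.mpr Ico_subset_Icc_self)
      structuredMeasure_compl_Ico
  have hm : AEMeasurable (fun x => ENNReal.ofReal (ρ x)) volI :=
    (integrable_of_memLp hρ).1.aemeasurable.ennreal_ofReal
  have hlt : ∀ᵐ x ∂volI, ENNReal.ofReal (ρ x) < ⊤ :=
    Filter.Eventually.of_forall fun x => ENNReal.ofReal_lt_top
  have e : (fun x => (ENNReal.ofReal (ρ x)).toReal • h x) =ᵐ[volI] fun x => ρ x * h x := by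
    filter_upwards [hρ0] with x hx
    rw [ENNReal.toReal_ofReal hx, smul_eq_mul]
  have i1 : Integrable h (volI.withDensity fun x => ENNReal.ofReal (ρ x)) := by
    rw [integrable_withDensity_iff_integrable_smul₀' hm hlt]
    exact (integrable_mul_of_memLp hρ (memLp_of_continuous hh)).congr e.symm
  have i2 : Integrable h (ENNReal.ofReal γ • Measure.dirac (-1)) :=
    (integrable_dirac (by simp)).smul_measure ENNReal.ofReal_ne_top
  rw [hr, structuredMeasure, integral_smul_measure, integral_add_measure i1 i2,
    integral_smul_measure, integral_dirac, ENNReal.toReal_ofReal hβ, ENNReal.toReal_ofReal hγ,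
    integral_withDensity_eq_integral_toReal_smul₀ hm hlt, integral_congr_ae e]
  rfl

end StructuredMeasure

/-! ### Uniqueness of multipliers -/

/-- Every function in `H¹(I; 1)` is thus the derivative of an element of `V`, so ramps may enter the
stationarity condition. -/
theorem memV_prim {Q w : ℝ → ℝ} (hQ : IsPrimitive Q w) (h1 : Q 1 = 0) :
    MemV (prim 0 Q) ∧ wd (prim 0 Q) =ᵐ[volI] Q ∧ wd (wd (prim 0 Q)) =ᵐ[volI] w ∧
      EqOn (rep (wd (prim 0 Q))) Q (Icc (-1) 1) := by
  have hZ := isPrimitive_prim 0 hQ.memLp_self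
  have e0 : prim 0 Q =ᵐ[volI] prim 0 Q := Filter.EventuallyEq.refl _ _
  have e1 := hZ.wd_ae_eq e0
  have er := hQ.rep_eqOn e1
  refine ⟨⟨hZ.memH (hQ.memH (k := 0) hQ.memLp (Filter.EventuallyEq.refl _ _)) e0, ?_, ?_⟩, e1,
    hQ.wd_ae_eq e1, er⟩
  · rw [hZ.rep_eqOn e0 (by simp), prim_neg_one]
  · rw [er (by simp), h1]

namespace IsMultiplier

variable {β : ℝ} {yd f ψ y : ℝ → ℝ} {μ ν : Measure ℝ}

/-- Stationarity gives the ramp from `a` to `b` the same integral under both measures, and on `[-1,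
1]` this ramp lies between the indicators of `Iic a` and `Iio b`. -/
theorem measure_Iic_le (hμ : IsMultiplier β yd f ψ y μ) (hν : IsMultiplier β yd f ψ y ν)
    {a b : ℝ} (hab : a < b) (hb : b ≤ 1) : μ (Iic a) ≤ ν (Iio b) := by
  have := hμ.finite
  have := hν.finite
  rcases lt_or_ge a (-1) with ha | ha
  · rw [measure_mono_null (fun x hx hm => ?_) hμ.carried]
    · exact zero_le
    · have h1 : x ≤ a := hx
      linarith [hm.1]
  obtain ⟨R, w, hR, h01, hR1, hR0, -⟩ := exists_ramp ha hab hb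
  obtain ⟨hV, -, -, hrep⟩ := memV_prim hR (hR0 1 (by simp) hb)
  have e : ∫ x in Icc (-1) 1, R x ∂μ = ∫ x in Icc (-1) 1, R x ∂ν := by
    rw [← setIntegral_congr_fun measurableSet_Icc hrep,
      ← setIntegral_congr_fun measurableSet_Icc hrep]
    linarith [hμ.stationarity _ hV, hν.stationarity _ hV]
  have key : ∀ κ : Measure ℝ, IsFiniteMeasure κ → κ (Icc (-1) 1)ᶜ = 0 →
      κ.real (Iic a) ≤ (∫ x in Icc (-1) 1, R x ∂κ) ∧
        (∫ x in Icc (-1) 1, R x ∂κ) ≤ κ.real (Iio b) := fun κ hfin hκ => by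
    have hr : κ.restrict (Icc (-1) 1) = κ := by
      refine Measure.restrict_eq_self_of_ae_mem ?_
      rw [ae_iff]
      exact hκ
    have hae : ∀ᵐ x ∂κ, x ∈ Icc (-1 : ℝ) 1 := by
      rw [ae_iff]
      exact hκ
    have hint : Integrable R κ := by
      rw [← hr]
      exact hR.cont.continuousOn.integrableOn_compact isCompact_Icc
    rw [hr]
    constructor
    · rw [← integral_indicator_one measurableSet_Iic]
      refine integral_mono_ae ((integrable_const 1).indicator measurableSet_Iic) hint ?_
      filter_upwards [hae] with x hx
      by_cases hxa : x ∈ Iic a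
      · rw [indicator_of_mem hxa, hR1 x hx hxa, Pi.one_apply]
      · rw [indicator_of_notMem hxa]
        exact (h01 x hx).1
    · rw [← integral_indicator_one measurableSet_Iio]
      refine integral_mono_ae hint ((integrable_const 1).indicator measurableSet_Iio) ?_
      filter_upwards [hae] with x hx
      by_cases hxb : x ∈ Iio b
      · rw [indicator_of_mem hxb]
        exact (h01 x hx).2
      · rw [indicator_of_notMem hxb, hR0 x hx (not_lt.mp hxb)]
  have h3 : μ.real (Iic a) ≤ ν.real (Iio b) :=
    (key μ hμ.finite hμ.carried).1.trans (e.le.trans (key ν hν.finite hν.carried).2)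
  exact (ENNReal.toReal_le_toReal (measure_ne_top _ _) (measure_ne_top _ _)).mp h3

theorem measure_Iio_le (hμ : IsMultiplier β yd f ψ y μ) (hν : IsMultiplier β yd f ψ y ν)
    {b : ℝ} (hb : b ≤ 1) : μ (Iio b) ≤ ν (Iio b) := by
  obtain ⟨u, hu, hlt, hlim⟩ := exists_seq_strictMono_tendsto b
  have e : μ (Iio b) = ⨆ n, μ (Iic (u n)) := by
    rw [← iUnion_Iic_eq_Iio_of_lt_of_tendsto hlt hlim,
      Monotone.measure_iUnion fun m n hmn => Iic_subset_Iic.mpr (hu.monotone hmn)]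
  exact e.trans_le (iSup_le fun n => hμ.measure_Iic_le hν (hlt n) hb)

theorem restrict_Iio_eq (hμ : IsMultiplier β yd f ψ y μ) (hν : IsMultiplier β yd f ψ y ν) :
    μ.restrict (Iio 1) = ν.restrict (Iio 1) := by
  have := hμ.finite
  have := hν.finite
  have h : ∀ b, μ.restrict (Iio 1) (Iio b) = ν.restrict (Iio 1) (Iio b) := fun b => by
    rw [Measure.restrict_apply measurableSet_Iio, Measure.restrict_apply measurableSet_Iio,
      Iio_inter_Iio]
    exact le_antisymm (hμ.measure_Iio_le hν inf_le_right) (hν.measure_Iio_le hμ inf_le_right)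
  refine Measure.ext_of_Ico _ _ fun a b hab => ?_
  have e : Ico a b = Iio b \ Iio a := by
    ext x
    simp
  rw [e, measure_sdiff (Iio_subset_Iio hab.le) measurableSet_Iio.nullMeasurableSet
    (measure_ne_top _ _), measure_sdiff (Iio_subset_Iio hab.le) measurableSet_Iio.nullMeasurableSet
    (measure_ne_top _ _), h, h]

/-- Multipliers are unique up to their mass at `1`. -/
theorem eq_add_dirac (hμ : IsMultiplier β yd f ψ y μ) (hν : IsMultiplier β yd f ψ y ν)
    (h1 : ν (Iio 1)ᶜ = 0) : μ = ν + μ {1} • Measure.dirac 1 := by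
  have hν' : ν.restrict (Iio 1) = ν := by
    refine Measure.restrict_eq_self_of_ae_mem ?_
    rw [ae_iff]
    exact h1
  have hc : μ.restrict (Iio 1)ᶜ = μ {1} • Measure.dirac 1 := by
    rw [← Measure.restrict_singleton]
    refine Measure.restrict_congr_set ?_
    have hae : ∀ᵐ x ∂μ, x ∈ Icc (-1 : ℝ) 1 := by
      rw [ae_iff]
      exact hμ.carried
    filter_upwards [hae] with x hx
    refine propext ⟨fun h => ?_, fun h => ?_⟩
    · exact le_antisymm hx.2 (not_lt.mp h)
    · have : x = 1 := h
      exact not_lt.mpr this.ge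
  rw [← hc, ← hν', ← hμ.restrict_Iio_eq hν, Measure.restrict_add_restrict_compl measurableSet_Iio]

/-- Complementarity of both measures leaves `μ {1} * (y'(1) - ψ(1)) = 0`, and the second factor is
nonzero. -/
theorem eq_of_pos (hμ : IsMultiplier β yd f ψ y μ) (hν : IsMultiplier β yd f ψ y ν)
    (h1 : ν (Iio 1)ᶜ = 0) (hc : Continuous fun x => rep (wd y) x - rep ψ x)
    (hlt : rep (wd y) 1 < rep ψ 1) : μ = ν := by
  have := hμ.finite
  have := hν.finite
  have e := hμ.eq_add_dirac hν h1
  have i1 : Integrable (fun x => rep (wd y) x - rep ψ x) (ν.restrict (Icc (-1) 1)) :=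
    hc.continuousOn.integrableOn_compact isCompact_Icc
  have i2 : Integrable (fun x => rep (wd y) x - rep ψ x)
      (((μ {1} • Measure.dirac 1 : Measure ℝ)).restrict (Icc (-1) 1)) := by
    have : IsFiniteMeasure (μ {1} • Measure.dirac (1 : ℝ)) :=
      Measure.smul_finite _ (measure_ne_top _ _)
    exact hc.continuousOn.integrableOn_compact isCompact_Icc
  have h2 := hμ.complementarity
  rw [e, Measure.restrict_add, integral_add_measure i1 i2, hν.complementarity, zero_add,
    Measure.restrict_smul, integral_smul_measure, setIntegral_dirac,
    if_pos (by simp), smul_eq_mul] at h2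
  have h3 := (mul_eq_zero.mp h2).resolve_right (sub_ne_zero.mpr hlt.ne)
  have h4 : μ {1} = 0 := ((ENNReal.toReal_eq_zero_iff _).mp h3).resolve_right (measure_ne_top _ _)
  rw [e, h4, zero_smul, add_zero]

end IsMultiplier

/-! ### From the variational inequality to the obstacle problem -/

theorem exists_isPotential {β : ℝ} (hβ : 0 < β) {yd y : ℝ → ℝ} (hyd : MemL2 yd)
    (hy : MemLp y 2 volI) :
    ∃ Φ φ : ℝ → ℝ, IsPrimitive Φ φ ∧ Φ 1 = 0 ∧ (∀ x, β * φ x = yd x - y x) ∧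
      IsPotential β yd y Φ := by
  let φ : ℝ → ℝ := fun x => β⁻¹ * (yd x - y x)
  have hyd' : MemLp yd 2 volI := hyd
  have hφ : MemLp φ 2 volI := (hyd'.sub hy).const_mul β⁻¹
  have hΦ := isPrimitive_prim (-∫ x in (-1)..1, φ x) hφ
  have h1 : prim (-∫ x in (-1)..1, φ x) φ 1 = 0 := by
    rw [prim_eq _ _ (by simp)]
    ring
  have hb : ∀ x, β * φ x = yd x - y x := fun x => by
    simp only [φ]
    rw [mul_inv_cancel_left₀ hβ.ne']
  have e : prim (-∫ x in (-1)..1, φ x) φ =ᵐ[volI] prim (-∫ x in (-1)..1, φ x) φ :=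
    Filter.EventuallyEq.refl _ _
  refine ⟨_, φ, hΦ, h1, hb, ⟨hΦ.memH (k := 0) hφ e, ?_⟩, ?_⟩
  · rw [hΦ.rep_eqOn e (by simp), h1]
  · filter_upwards [hΦ.wd_ae_eq e] with x hx
    rw [hx, hb]

/-- The derivative of the cost in the direction of a primitive `Z` of `Q`. -/
theorem cost_derivative_eq {β : ℝ} {yd y f Φ φ q : ℝ → ℝ} (hΦ : IsPrimitive Φ φ)
    (hΦ1 : Φ 1 = 0) (hφ : ∀ x, β * φ x = yd x - y x) (hq : MemLp q 2 volI)
    (hf : MemLp f 2 volI) {Z Q w : ℝ → ℝ} (hZ : IsPrimitive Z Q)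
    (hQ : IsPrimitive Q w) (hZ0 : Z (-1) = 0) (hQ1 : Q 1 = 0) :
    (∫ x in I, (y x - yd x) * Z x) + β * (∫ x in I, (q x + f x) * w x) =
      β * ∫ x in I, (q x + f x - prim 0 Φ x) * w x := by
  have hP := isPrimitive_prim 0 hΦ.memLp_self
  -- All boundary terms vanish: `Φ` and `Q` are zero at `1`, `Z` and the primitive of `Φ` at `-1`.
  have e1 := hΦ.integral_mul_add hZ
  have e2 := hP.integral_mul_add hQ
  rw [hΦ1, hZ0] at e1
  rw [prim_neg_one, hQ1] at e2
  have e3 : ∫ x in I, (y x - yd x) * Z x = -(β * ∫ x in I, φ x * Z x) := by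
    rw [← integral_const_mul, ← integral_neg]
    congr 1
    ext x
    rw [← mul_assoc, hφ]
    ring
  have hqf : MemLp (fun x => q x + f x) 2 volI := hq.add hf
  have e4 : ∫ x in I, (q x + f x - prim 0 Φ x) * w x =
      (∫ x in I, (q x + f x) * w x) - ∫ x in I, prim 0 Φ x * w x := by
    simp_rw [sub_mul]
    exact integral_I_sub (integrable_mul_of_memLp hqf hQ.memLp)
      (integrable_mul_of_memLp hP.memLp_self hQ.memLp)
  rw [e3, e4]
  linear_combination (-β) * e1 + β * e2

/-- The variational inequality in terms of the derivative of the state. -/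
theorem SolvesVI.nonnegBelow {β : ℝ} (hβ : 0 < β) {yd f ψ y Φ φ : ℝ → ℝ}
    (h : SolvesVI β yd f ψ y) (hf : MemH 1 f) (hψ : MemH 2 ψ) (hΦ : IsPrimitive Φ φ)
    (hΦ1 : Φ 1 = 0) (hφ : ∀ x, β * φ x = yd x - y x) :
    NonnegBelow (fun x => wd (wd y) x + f x - prim 0 Φ x)
      (fun x => rep ψ x - rep (wd y) x) := by
  obtain ⟨hK, hvi⟩ := h
  intro Q w hQ hQ1 hle
  obtain ⟨hyP, hyae⟩ := hK.1.1.of_succ.isPrimitive_rep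
  obtain ⟨hpP, hpae⟩ := hK.1.1.wd.isPrimitive_rep
  obtain ⟨-, hψae⟩ := hψ.of_succ.isPrimitive_rep
  have hZ := isPrimitive_prim 0 hQ.memLp_self
  have s1 := (hyP.congr_ae hpae).add hZ
  have s2 := hpP.add hQ
  have a1 : (fun x => y x + prim 0 Q x) =ᵐ[volI] fun x => rep y x + prim 0 Q x := by
    filter_upwards [hyae] with x hx
    rw [hx]
  have a2 := s1.wd_ae_eq a1
  have a3 := s2.wd_ae_eq a2
  have hz : MemK ψ (fun x => y x + prim 0 Q x) := by
    refine ⟨⟨s1.memH (s2.memH (k := 0) s2.memLp (Filter.EventuallyEq.refl _ _)) a1, ?_, ?_⟩, ?_⟩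
    · refine (s1.rep_eqOn a1 (by simp)).trans ?_
      simp only [hK.1.2.1, prim_neg_one, add_zero]
    · refine (s2.rep_eqOn a2 (by simp)).trans ?_
      simp only [hK.1.2.2, hQ1, add_zero]
    · filter_upwards [a2, hψae, ae_volI_mem] with x h1 h2 hx
      rw [h1, h2]
      linarith [hle x ⟨hx.1.le, hx.2.le⟩]
  have key := hvi _ hz
  have e1 : ∫ x in I, (wd (wd y) x + f x) *
      (wd (wd (fun x => y x + prim 0 Q x)) x - wd (wd y) x) =
      ∫ x in I, (wd (wd y) x + f x) * w x := by
    refine integral_I_congr ?_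
    filter_upwards [a3] with x hx
    rw [hx, add_sub_cancel_left]
  simp_rw [add_sub_cancel_left] at key
  rw [e1, cost_derivative_eq hΦ hΦ1 hφ hpP.memLp hf.memLp hZ hQ (prim_neg_one _ _) hQ1] at key
  exact nonneg_of_mul_nonneg_right key hβ

/-- Structure of the solution of the variational inequality: `y'' + f - ∫ Φ` is a nonnegative
nondecreasing function in `H¹(I)`, which increases only where the constraint is active. -/
theorem SolvesVI.exists_isPrimitive {β : ℝ} (hβ : 0 < β) {yd f ψ y Φ φ : ℝ → ℝ}
    (h : SolvesVI β yd f ψ y) (hf : MemH 1 f) (hψ : MemH 2 ψ)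
    (hΦ : IsPrimitive Φ φ) (hΦ1 : Φ 1 = 0) (hφ : ∀ x, β * φ x = yd x - y x) :
    ∃ g ρ : ℝ → ℝ, IsPrimitive g ρ ∧
      (fun x => wd (wd y) x + f x - prim 0 Φ x) =ᵐ[volI] g ∧ 0 ≤ᵐ[volI] ρ ∧ 0 ≤ g (-1) ∧
      (∀ᵐ x ∂volI, ρ x * (rep ψ x - rep (wd y) x) = 0) ∧
      g (-1) * (rep ψ (-1) - rep (wd y) (-1)) = 0 := by
  have H := h.nonnegBelow hβ hf hψ hΦ hΦ1 hφ
  obtain ⟨hK, -⟩ := h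
  obtain ⟨hpP, hpae⟩ := hK.1.1.wd.isPrimitive_rep
  obtain ⟨hψP, hψae⟩ := hψ.of_succ.isPrimitive_rep
  obtain ⟨hψ'P, hψ'ae⟩ := hψ.wd.isPrimitive_rep
  obtain ⟨hfP, hfae⟩ := hf.isPrimitive_rep
  have hP := isPrimitive_prim 0 hΦ.memLp_self
  have hv := hψP.sub hpP
  have hG := (hψ'P.add hfP).sub hP
  have hg : MemLp (fun x => wd (wd y) x + f x - prim 0 Φ x) 2 volI :=
    (hpP.memLp.add hf.memLp).sub hP.memLp_self
  -- Adding and subtracting `f - ∫Φ` writes `v' = ψ' - y''` as `G - g` with `G` in `H¹`.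
  have hv' := hv.congr_ae (z := fun x => (rep (wd ψ) x + rep f x - prim 0 Φ x) -
      (wd (wd y) x + f x - prim 0 Φ x)) (by
    filter_upwards [hψ'ae, hfae] with x h1 h2
    rw [h1, h2]
    ring)
  have hv0 : ∀ x ∈ Icc (-1 : ℝ) 1, 0 ≤ rep ψ x - rep (wd y) x := by
    have hle : ∀ᵐ x ∂volume.restrict I, rep (wd y) x ≤ rep ψ x := by
      have : ∀ᵐ x ∂volI, rep (wd y) x ≤ rep ψ x := by
        filter_upwards [hK.2, hpae, hψae] with x h1 h2 h3
        rwa [← h2, ← h3]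
      exact this
    -- The almost everywhere inequality, written as an equality of continuous functions, extends to
    -- all of `[-1, 1]`.
    have he : (fun x => max (rep (wd y) x) (rep ψ x)) =ᵐ[volI] rep ψ := by
      filter_upwards [hle] with x hx using max_eq_right hx
    intro x hx
    have := eqOn_Icc_of_ae_eq (hpP.cont.max hψP.cont) hψP.cont he hx
    exact sub_nonneg.mpr (max_eq_right_iff.mp this)
  obtain ⟨g, ρ, h1, h2, h3, h4⟩ := H.exists_isPrimitive hg hv0 hG hv'
  obtain ⟨h5, h6⟩ := H.complementarity hv0 hv h1 h2 h3 h4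
  exact ⟨g, ρ, h1, h2, h3, h4, h5, h6⟩

/-! ### Multiplier, adjoint equation and obstacle problem -/

section Consequences

variable {β : ℝ} {yd f ψ y Φ φ g ρ : ℝ → ℝ}

/-- The source of the density and of the point mass: since `Q 1 = 0`, only the left end point
contributes. -/
theorem integral_mul_eq_neg {a w Q : ℝ → ℝ} (hg : IsPrimitive g ρ) (ha : a =ᵐ[volI] g)
    (hQ : IsPrimitive Q w) (hQ1 : Q 1 = 0) :
    ∫ x in I, a x * w x = -((∫ x in I, ρ x * Q x) + g (-1) * Q (-1)) := by
  have e1 := hg.integral_mul_add hQ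
  have e2 : ∫ x in I, a x * w x = ∫ x in I, g x * w x := by
    refine integral_I_congr ?_
    filter_upwards [ha] with x hx
    rw [hx]
  rw [e2]
  rw [hQ1] at e1
  linarith

theorem isMultiplier_structuredMeasure (hβ : 0 < β) (hK : MemK ψ y) (hf : MemH 1 f)
    (hψ : MemH 2 ψ) (hΦ : IsPrimitive Φ φ) (hΦ1 : Φ 1 = 0) (hφ : ∀ x, β * φ x = yd x - y x)
    (hg : IsPrimitive g ρ) (hae : (fun x => wd (wd y) x + f x - prim 0 Φ x) =ᵐ[volI] g)
    (hρ : 0 ≤ᵐ[volI] ρ) (hγ : 0 ≤ g (-1))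
    (hcρ : ∀ᵐ x ∂volI, ρ x * (rep ψ x - rep (wd y) x) = 0)
    (hcγ : g (-1) * (rep ψ (-1) - rep (wd y) (-1)) = 0) :
    IsMultiplier β yd f ψ y (structuredMeasure β ρ (g (-1))) where
  finite := isFiniteMeasure_structuredMeasure hg.memLp
  carried := measure_mono_null (compl_subset_compl.mpr Ico_subset_Icc_self)
    structuredMeasure_compl_Ico
  stationarity z hz := by
    obtain ⟨hzP, hzae⟩ := hz.1.of_succ.isPrimitive_rep
    obtain ⟨hqP, hqae⟩ := hz.1.wd.isPrimitive_rep
    have e := cost_derivative_eq hΦ hΦ1 hφ hK.1.1.wd.wd.memLp hf.memLp (hzP.congr_ae hqae) hqP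
      hz.2.1 hz.2.2
    have e1 : ∫ x in I, (y x - yd x) * z x = ∫ x in I, (y x - yd x) * rep z x := by
      refine integral_I_congr ?_
      filter_upwards [hzae] with x hx
      rw [hx]
    rw [integral_structuredMeasure hβ.le hγ hg.memLp hρ hqP.cont, e1, e,
      integral_mul_eq_neg hg hae hqP hz.2.2]
    ring
  complementarity := by
    have hpP := hK.1.1.wd.isPrimitive_rep.1
    have hψP := hψ.of_succ.isPrimitive_rep.1
    rw [integral_structuredMeasure hβ.le hγ hg.memLp hρ (h := fun x => rep (wd y) x - rep ψ x)
      (hpP.cont.sub hψP.cont)]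
    have e : ∫ x in I, ρ x * (rep (wd y) x - rep ψ x) = ∫ x in I, (0 : ℝ) := by
      refine integral_I_congr ?_
      filter_upwards [hcρ] with x hx
      linarith
    rw [e, integral_zero, zero_add]
    linear_combination (-β) * hcγ

theorem solvesAdjoint {p D : ℝ → ℝ} (hp : MemH1Right p) (hf : MemH 1 f) (hΦ : IsPrimitive Φ φ)
    (hρ : MemL2 ρ) {γ : ℝ} (hD : IsPrimitive D fun x => ρ x - wd f x + Φ x)
    (hpD : wd p =ᵐ[volI] D) (hD1 : D (-1) = γ - rep f (-1)) : SolvesAdjoint f Φ ρ γ p := by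
  refine ⟨hp, fun q hq => ?_⟩
  obtain ⟨hqP, hqae⟩ := hq.1.isPrimitive_rep
  have hq2 := hq.1.memLp
  have hρ' : MemLp ρ 2 volI := hρ
  rw [integral_mul_eq_neg hD hpD hqP hq.2, hD1]
  have e : ∫ x in I, (ρ x - wd f x + Φ x) * rep q x =
      (∫ x in I, Φ x * q x) - ∫ x in I, (wd f x - ρ x) * q x := by
    rw [← integral_I_sub (integrable_mul_of_memLp hΦ.memLp_self hq2)
      (integrable_mul_of_memLp (u := fun x => wd f x - ρ x) (hf.wd.memLp.sub hρ') hq2)]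
    refine integral_I_congr ?_
    filter_upwards [hqae] with x hx
    rw [← hx]
    ring
  rw [e]
  ring

/-- The competitor is `q - p`. Integrating the terms with `f` and `∫Φ` by parts leaves a boundary
term from `f` only, since `∫Φ` vanishes at `-1`. -/
theorem solvesObstacle {p : ℝ → ℝ} (hp : MemH1Right p) (hle : p ≤ᵐ[volI] ψ) (hf : MemH 1 f)
    (hψ : MemH 1 ψ) (hΦ : IsPrimitive Φ φ)
    (H : NonnegBelow (fun x => wd p x + f x - prim 0 Φ x) fun x => rep ψ x - rep p x) :
    SolvesObstacle f ψ Φ p := by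
  refine ⟨⟨hp, hle⟩, fun q hq hqle => ?_⟩
  obtain ⟨hqP, hqae⟩ := hq.1.isPrimitive_rep
  obtain ⟨hpP, hpae⟩ := hp.1.isPrimitive_rep
  obtain ⟨hψP, hψae⟩ := hψ.isPrimitive_rep
  obtain ⟨hfP, hfae⟩ := hf.isPrimitive_rep
  have hP := isPrimitive_prim 0 hΦ.memLp_self
  have hQ := hqP.sub hpP
  have hQ1 : rep q 1 - rep p 1 = 0 := by rw [hq.2, hp.2, sub_zero]
  have he : (fun x => max (rep q x) (rep ψ x)) =ᵐ[volI] rep ψ := by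
    filter_upwards [hqle, hqae, hψae] with x h1 h2 h3
    rw [← h2, ← h3]
    exact max_eq_right h1
  have key := H _ _ hQ hQ1 fun x hx => sub_le_sub_right
    (max_eq_right_iff.mp (eqOn_Icc_of_ae_eq (hqP.cont.max hψP.cont) hψP.cont he hx)) _
  have e1 := integral_mul_eq_neg hfP hfae hQ hQ1
  have e2 := integral_mul_eq_neg hP (Filter.EventuallyEq.refl _ _) hQ hQ1
  rw [prim_neg_one, zero_mul, add_zero] at e2
  have i1 := integrable_mul_of_memLp hpP.memLp hQ.memLp
  have i2 := integrable_mul_of_memLp hf.memLp hQ.memLp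
  have i3 := integrable_mul_of_memLp hP.memLp_self hQ.memLp
  have e3 : ∫ x in I, (wd p x + f x - prim 0 Φ x) * (wd q x - wd p x) =
      (∫ x in I, wd p x * (wd q x - wd p x)) + (∫ x in I, f x * (wd q x - wd p x)) -
        ∫ x in I, prim 0 Φ x * (wd q x - wd p x) := by
    simp_rw [sub_mul, add_mul]
    rw [integral_I_sub (f := fun x => wd p x * (wd q x - wd p x) + f x * (wd q x - wd p x))
      (i1.add i2) i3, integral_I_add i1 i2]
  have e4 : ∫ x in I, (Φ x - wd f x) * (q x - p x) =
      (∫ x in I, Φ x * (rep q x - rep p x)) - ∫ x in I, wd f x * (rep q x - rep p x) := by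
    rw [← integral_I_sub (integrable_mul_of_memLp hΦ.memLp_self hQ.memLp_self)
      (integrable_mul_of_memLp hfP.memLp hQ.memLp_self)]
    refine integral_I_congr ?_
    filter_upwards [hqae, hpae] with x h1 h2
    rw [← h1, ← h2]
    ring
  rw [e3, e1, e2] at key
  rw [e4]
  linarith

end Consequences

end

end DerivativeConstraint

/-! ### The theorem -/

open DerivativeConstraint in
theorem theorem2p6 (β : ℝ) (hβ : 0 < β) (yd f ψ : ℝ → ℝ)
    (hyd : MemL2 yd) (hf : MemH 1 f) (hψ : MemH 2 ψ) (hψ1 : 0 ≤ rep ψ 1) (y : ℝ → ℝ) :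
    (IsOptimalState β yd f ψ y ↔ SolvesVI β yd f ψ y) ∧
    (IsOptimalState β yd f ψ y →
      MemH 3 y ∧
      ∃ (ρ : ℝ → ℝ) (γ : ℝ), MemL2 ρ ∧ 0 ≤ᵐ[volI] ρ ∧ 0 ≤ γ ∧
        IsMultiplier β yd f ψ y (structuredMeasure β ρ γ) ∧
        (∀ μ, IsMultiplier β yd f ψ y μ →
          μ = structuredMeasure β ρ γ + μ {1} • Measure.dirac 1 ∧
          (0 < rep ψ 1 → μ = structuredMeasure β ρ γ)) ∧
        ∃ Φ p : ℝ → ℝ, IsPotential β yd y Φ ∧ MemH 2 p ∧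
          SolvesAdjoint f Φ ρ γ p ∧ SolvesObstacle f ψ Φ p ∧
          wd y =ᵐ[volI] p ∧ wd (wd y) =ᵐ[volI] wd p ∧
          (∀ᵐ x ∂volI, ρ x = wd (wd p) x + wd f x - Φ x) ∧
          γ = rep f (-1) + rep (wd p) (-1)) := by
  refine ⟨isOptimalState_iff_solvesVI hβ hyd hf y, fun hopt => ?_⟩
  have hVI := (isOptimalState_iff_solvesVI hβ hyd hf y).mp hopt
  have hK := hVI.1
  obtain ⟨Φ, φ, hΦ, hΦ1, hφ, hpot⟩ := exists_isPotential hβ hyd hK.1.1.memLp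
  obtain ⟨g, ρ, hg, hae, hρ, hγ, hcρ, hcγ⟩ :=
    hVI.exists_isPrimitive hβ hf hψ hΦ hΦ1 hφ
  have hmul := isMultiplier_structuredMeasure hβ hK hf hψ hΦ hΦ1 hφ hg hae hρ hγ hcρ hcγ
  obtain ⟨hyP, hyae⟩ := hK.1.1.of_succ.isPrimitive_rep
  obtain ⟨hpP, hpae⟩ := hK.1.1.wd.isPrimitive_rep
  obtain ⟨hψP, -⟩ := hψ.of_succ.isPrimitive_rep
  obtain ⟨hfP, hfae⟩ := hf.isPrimitive_rep
  -- Solving the definition of `g` for `y''` exhibits it as an `H¹` function with derivative `ρ - f'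
  -- + Φ`; this yields `y ∈ H³` and the formulas for `ρ` and `γ`.
  have hD := (hg.sub hfP).add (isPrimitive_prim 0 hΦ.memLp_self)
  have hpD : wd (wd y) =ᵐ[volI] fun x => g x - rep f x + prim 0 Φ x := by
    filter_upwards [hae, hfae] with x h1 h2
    rw [← h1, ← h2]
    ring
  have hD1 : g (-1) - rep f (-1) + prim 0 Φ (-1) = g (-1) - rep f (-1) := by
    rw [prim_neg_one, add_zero]
  have hp2 : MemH 2 (wd y) := hpP.memH (hD.memH (k := 0) hD.memLp hpD) hpae
  have hpR : MemH1Right (wd y) := ⟨hK.1.1.wd, hK.1.2.2⟩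
  refine ⟨hyP.memH hp2 hyae, ρ, g (-1), hg.memLp, hρ, hγ, hmul, fun μ hμ => ?_, Φ, wd y, hpot, hp2,
    solvesAdjoint hpR hf hΦ hg.memLp hD hpD hD1,
    solvesObstacle hpR hK.2 hf hψ.of_succ hΦ (hVI.nonnegBelow hβ hf hψ hΦ hΦ1 hφ),
    Filter.EventuallyEq.refl _ _, Filter.EventuallyEq.refl _ _, ?_, ?_⟩
  · have h0 : structuredMeasure β ρ (g (-1)) (Iio 1)ᶜ = 0 :=
      measure_mono_null (compl_subset_compl.mpr fun x hx => hx.2) structuredMeasure_compl_Ico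
    refine ⟨hμ.eq_add_dirac hmul h0, fun hpos => ?_⟩
    exact hμ.eq_of_pos hmul h0 (hpP.cont.sub hψP.cont) (by rwa [hK.1.2.2])
  · filter_upwards [hD.wd_ae_eq hpD] with x hx
    rw [hx]
    ring
  · rw [hD.rep_eqOn hpD (by simp)]
    linarith
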